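/- **Setting.** Let $d\ge 1$, let $\mathcal I$ be a finite set and let $\mathcal A=\{A_i\}_{i\in\mathcal I}$ be a family of invertible real $d\times d$ matrices. Write $\mathcal L_d$ for Lebesgue measure on $\mathbb R^d$, $\|\cdot\|$ for the operator norm induced by the Euclidean norm, and $\lambda(\mathcal A)=\sum_{i\in\mathcal I}|\det A_i|$. For $\mathcal T=(t_i)_{i\in\mathcal I}\in\mathbb R^{\#\mathcal I\cdot d}$ put $S_{i,\mathcal T}(x)=A_ix+t_i$ and $T_{i,\mathcal T}=S_{i,\mathcal T}^{-1}$. Let $X_{\mathcal T}$ be the unique non-empty compact set with $X_{\mathcal T}=\bigcup_{i\in\mathcal I}S_{i,\mathcal T}(X_{\mathcal T})$, and for $\mathbf i=(i_n)_{n\ge1}\in\mathcal I^{\mathbb N}$ let $$\pi_{\mathcal T}(\mathbf i)=\lim_{n\to\infty}(S_{i_1,\mathcal T}\circ\cdots\circ S_{i_n,\mathcal T})(0)=t_{i_1}+\sum_{n=1}^\infty A_{i_1}\cdots A_{i_n}t_{i_{n+1}}.$$ For points $\mathbf x=(x_n)_{n\ge1}$ of $X_{\mathcal T}$ and sets $E_n\subset\mathbb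 R^d$, let $W(\mathcal S_{\mathcal T},\mathbf x,(E_n))$ be the set of $x\in X_{\mathcal T}$ such that $(T_{i_N,\mathcal T}\circ\cdots\circ T_{i_1,\mathcal T})(x)\in x_N+E_N$ for infinitely many words $(i_1,\ldots,i_N)\in\bigcup_{n\ge1}\mathcal I^n$, and let $R(\mathcal S_{\mathcal T},(E_n))$ be the set of $x\in X_{\mathcal T}$ such that $(T_{i_N,\mathcal T}\circ\cdots\circ T_{i_1,\mathcal T})(x)\in x+E_N$ for infinitely many such words. For $y\in X_{\mathcal T}$ and $C>0$ let $W(\mathcal S_{\mathcal T},y,C)$ be the set of $x\in X_{\mathcal T}$ such that $(T_{i_N,\mathcal T}\circ\cdots\circ T_{i_1,\mathcal T})(x)\in B\big(y,(C/\lambda(\mathcal A)^N)^{1/d}\big)$ for infinitely many such words. A family $\mathcal V$ of open sets is a *density basis* for a Borel set $X\subset\mathbb R^d$ if every $x\in X$ lies in arbitrarily small members of $\mathcal V$ and, for every Borel set $B\subset X$, for Lebesgue almost every $x\in\mathbb R^d$ we have $\mathcal L_d(V\cap B)/\mathcal L_d(V)\to\chi_B(x)$ as $V\to x$ with $x\in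 V\in\mathcal V$. Here $V\to x$ means $\mathrm{diam}(V\cup\{x\})\to0$, and the condition is void at points $x$ that do not lie in arbitrarily small members of $\mathcal V$. The set $X=X_{\mathcal T}$ is *differentiation regular* if $\mathcal L_d(X)>0$ and there are a density basis $\mathcal V$ for $X$ and $\eta>0$ such that for every $x\in X$ there is a sequence $V_j\in\mathcal V$ with $x\in V_j$, $V_j\to x$, and for each $j$ a word $(i_1,\ldots,i_n)$ with $(S_{i_1,\mathcal T}\circ\cdots\circ S_{i_n,\mathcal T})(X)\subset V_j$ and $\mathcal L_d\big((S_{i_1,\mathcal T}\circ\cdots\circ S_{i_n,\mathcal T})(X)\big)\ge\eta\,\mathcal L_d(V_j)$. A sequence $(E_n)_{n\ge1}$ of Borel subsets of $\mathbb R^d$ is called *admissible* if * there is $Q>0$ with $E_n\subset[-Q,Q]^d$ for all $n$; * $\mathcal L_d(E_n)=\lambda(\mathcal A)^{-n}$ for all $n$; * $s\cdot E_n\subset E_n$ for all $s\in(0,1)$ and all $n$; * there is $C>0$ such that for each $n$ there is $r_n>0$ with $\mathcal L_d([-r_n,r_n]^d+E_n)\le C\mathcal L_d(E_n)$ and $\mathcal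 L_d([-r_n,r_n]^d-E_n)\le C\mathcal L_d(E_n)$. **Theorem.** Assume that $\|A_i\|<1/2$ for all $i\in\mathcal I$ and that $\lambda(\mathcal A)>1$. Then the following hold. 1. Let $(i_{n,m})\in\mathcal I^{\mathbb N\times\mathbb N}$, let $(E_n)$ be admissible, and put $x_n(\mathcal T)=\pi_{\mathcal T}((i_{n,m})_{m\ge1})$. Then for Lebesgue almost every $\mathcal T\in\mathbb R^{\#\mathcal I\cdot d}$, $$\limsup_{n\to\infty}\mathcal L_d\big(\{x:\exists (i_1,\ldots,i_n)\in\mathcal I^n\text{ such that }(T_{i_n,\mathcal T}\circ\cdots\circ T_{i_1,\mathcal T})(x)\in x_n(\mathcal T)+E_n\}\big)>0.$$ Moreover, for Lebesgue almost every $\mathcal T$, the set $W(\mathcal S_{\mathcal T},(x_n(\mathcal T))_{n\ge1},(E_n))$ has positive Lebesgue measure. 2. Let $\mathbf i\in\mathcal I^{\mathbb N}$ and assume that $X_{\mathcal T}$ is differentiation regular for Lebesgue almost every $\mathcal T\in\mathbb R^{\#\mathcal I\cdot d}$. Then for Lebesgue almost every $\mathcal T$, Lebesgue almost every $x\in X_{\mathcal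 T}$ belongs to $\bigcup_{C>0}W(\mathcal S_{\mathcal T},\pi_{\mathcal T}(\mathbf i),C)$. 3. Let $(E_n)$ be admissible. Then for Lebesgue almost every $\mathcal T\in\mathbb R^{\#\mathcal I\cdot d}$, $$\limsup_{n\to\infty}\mathcal L_d\big(\{x:\exists (i_1,\ldots,i_n)\in\mathcal I^n\text{ such that }(T_{i_n,\mathcal T}\circ\cdots\circ T_{i_1,\mathcal T})(x)\in x+E_n\}\big)>0.$$ Moreover, for Lebesgue almost every $\mathcal T$, the set $R(\mathcal S_{\mathcal T},(E_n))$ has positive Lebesgue measure. -/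

import Mathlib

open Set Filter Topology MeasureTheory
open scoped Pointwise ENNReal

namespace SelfAffine

/-- Euclidean space `ℝ^d` with the Euclidean norm and Lebesgue measure. -/
abbrev Euc (d : ℕ) : Type := EuclideanSpace ℝ (Fin d)

section IFS

variable {d : ℕ} {ι : Type*}

/-- The linear map of `ℝ^d` given by a matrix, as a bounded operator; its norm is the operator norm
for the Euclidean norm. -/
noncomputable def lin (M : Matrix (Fin d) (Fin d) ℝ) : Euc d →L[ℝ] Euc d :=
  Matrix.toEuclideanCLM (n := Fin d) (𝕜 := ℝ) M

/-- The map `S_i(x) = A_i x + t_i`. -/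
noncomputable def S (A : ι → Matrix (Fin d) (Fin d) ℝ) (t : ι → Euc d) (i : ι) (x : Euc d) :
    Euc d :=
  lin (A i) x + t i

/-- The map `T_i = S_i⁻¹`, that is `T_i(x) = A_i⁻¹ (x - t_i)` (see `T_S` and `S_T`). -/
noncomputable def T (A : ι → Matrix (Fin d) (Fin d) ℝ) (t : ι → Euc d) (i : ι) (x : Euc d) :
    Euc d :=
  lin (A i)⁻¹ (x - t i)

/-- For the word `w = (i_1, …, i_n)`, the composition `S_{i_1} ∘ ⋯ ∘ S_{i_n}`. -/
noncomputable def SWord (A : ι → Matrix (Fin d) (Fin d) ℝ) (t : ι → Euc d) (w : List ι)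
    (x : Euc d) : Euc d :=
  w.foldr (fun i y => S A t i y) x

/-- For the word `w = (i_1, …, i_n)`, the composition `T_{i_n} ∘ ⋯ ∘ T_{i_1}`. -/
noncomputable def TWord (A : ι → Matrix (Fin d) (Fin d) ℝ) (t : ι → Euc d) (w : List ι)
    (x : Euc d) : Euc d :=
  w.foldl (fun y i => T A t i y) x

/-- The number `λ(𝒜) = ∑ |det A_i|`. -/
noncomputable def detSum [Fintype ι] (A : ι → Matrix (Fin d) (Fin d) ℝ) : ℝ :=
  ∑ i, |(A i).det|

/-- `X` is a non-empty compact set with `X = ⋃ S_i(X)`. -/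
def IsSelfAffineSet (A : ι → Matrix (Fin d) (Fin d) ℝ) (t : ι → Euc d) (X : Set (Euc d)) : Prop :=
  X.Nonempty ∧ IsCompact X ∧ X = ⋃ i, S A t i '' X

/-- The self-affine set `X` of the system: the non-empty compact set with `X = ⋃ S_i(X)`. For a
non-empty finite system of contractions it exists and is unique, see
`existsUnique_isSelfAffineSet`. -/
noncomputable def selfAffineSet (A : ι → Matrix (Fin d) (Fin d) ℝ) (t : ι → Euc d) :
    Set (Euc d) :=
  Classical.epsilon (IsSelfAffineSet A t)

/-- The projection of the sequence `(i_1, i_2, …)`, here indexed from `0`: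
`t_{i_1} + ∑_{n ≥ 1} A_{i_1} ⋯ A_{i_n} t_{i_{n+1}}`. The series converges for contractions, and it
is the limit of `(S_{i_1} ∘ ⋯ ∘ S_{i_n})(0)`, see `tendsto_SWord_projection`. -/
noncomputable def projection (A : ι → Matrix (Fin d) (Fin d) ℝ) (t : ι → Euc d) (i : ℕ → ι) :
    Euc d :=
  ∑' n : ℕ, lin (List.ofFn fun k : Fin n => A (i k)).prod (t (i n))

/-- The shrinking target set `W(𝒮, (x_n), (E_n))`. -/
def targetSet (A : ι → Matrix (Fin d) (Fin d) ℝ) (t : ι → Euc d) (x : ℕ → Euc d)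
    (E : ℕ → Set (Euc d)) : Set (Euc d) :=
  {y | y ∈ selfAffineSet A t ∧
    {w : List ι | w ≠ [] ∧ TWord A t w y ∈ x w.length +ᵥ E w.length}.Infinite}

/-- The shrinking target set `W(𝒮, (x_n), h)`, with targets the balls centred at `x_n` of radius
`(h(n) / λ(𝒜)^n)^{1/d}`. -/
def ballTargetSet [Fintype ι] (A : ι → Matrix (Fin d) (Fin d) ℝ) (t : ι → Euc d) (x : ℕ → Euc d)
    (h : ℕ → ℝ) : Set (Euc d) :=
  {y | y ∈ selfAffineSet A t ∧
    {w : List ι | w ≠ [] ∧ TWord A t w y ∈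
      Metric.ball (x w.length) ((h w.length / detSum A ^ w.length) ^ (1 / (d : ℝ)))}.Infinite}

/-- The recurrence set `R(𝒮, (E_n))`. -/
def recurrenceSet (A : ι → Matrix (Fin d) (Fin d) ℝ) (t : ι → Euc d) (E : ℕ → Set (Euc d)) :
    Set (Euc d) :=
  {y | y ∈ selfAffineSet A t ∧
    {w : List ι | w ≠ [] ∧ TWord A t w y ∈ y +ᵥ E w.length}.Infinite}

/-- The points that some word of length `n` maps into the target `x + E`. -/
def levelTargetSet (A : ι → Matrix (Fin d) (Fin d) ℝ) (t : ι → Euc d) (n : ℕ) (x : Euc d)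
    (E : Set (Euc d)) : Set (Euc d) :=
  {y | ∃ w : List ι, w.length = n ∧ TWord A t w y ∈ x +ᵥ E}

/-- The points `y` that some word of length `n` maps into `y + E`. -/
def levelRecurrenceSet (A : ι → Matrix (Fin d) (Fin d) ℝ) (t : ι → Euc d) (n : ℕ)
    (E : Set (Euc d)) : Set (Euc d) :=
  {y | ∃ w : List ι, w.length = n ∧ TWord A t w y ∈ y +ᵥ E}

end IFS

section Targets

variable {d : ℕ}

/-- The cube `[-r, r]^d`. -/
def cube (d : ℕ) (r : ℝ) : Set (Euc d) := {x | ∀ k, x k ∈ Icc (-r) r}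

/-- The conditions on the sets `E_n`, `n ≥ 1`, with `L = λ(𝒜)`. The value `E 0` plays no role. -/
structure RegularTargets (L : ℝ) (E : ℕ → Set (Euc d)) : Prop where
  measurable : ∀ n, 1 ≤ n → MeasurableSet (E n)
  bounded : ∃ Q : ℝ, 0 < Q ∧ ∀ n, 1 ≤ n → E n ⊆ cube d Q
  volume_eq : ∀ n, 1 ≤ n → volume (E n) = ENNReal.ofReal ((L ^ n)⁻¹)
  smul_subset : ∀ s ∈ Ioo (0 : ℝ) 1, ∀ n, 1 ≤ n → s • E n ⊆ E n
  fattening : ∃ C : ℝ, 0 < C ∧ ∀ n, 1 ≤ n → ∃ r : ℝ, 0 < r ∧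
    volume (cube d r + E n) ≤ ENNReal.ofReal C * volume (E n) ∧
    volume (cube d r - E n) ≤ ENNReal.ofReal C * volume (E n)

end Targets

section Differentiation

variable {d : ℕ} {ι : Type*}

/-- The filter of sets `V` with `V → x`, that is `diam (V ∪ {x}) → 0`. -/
noncomputable def shrinkingTo (x : Euc d) : Filter (Set (Euc d)) :=
  comap (fun V => Metric.ediam (V ∪ {x})) (𝓝 0)

/-- A family `𝒱` of open sets is a density basis for `X`: every `x ∈ X` lies in arbitrarily small
members of `𝒱`, and for every Borel set `B ⊆ X` and almost every `x ∈ ℝ^d`, the ratio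
`ℒ(V ∩ B) / ℒ(V)` tends to `χ_B(x)` as `V → x` with `x ∈ V ∈ 𝒱`. -/
structure IsDensityBasis (𝒱 : Set (Set (Euc d))) (X : Set (Euc d)) : Prop where
  isOpen : ∀ V ∈ 𝒱, IsOpen V
  small : ∀ x ∈ X, ∀ ε : ℝ≥0∞, 0 < ε → ∃ V ∈ 𝒱, x ∈ V ∧ Metric.ediam V < ε
  density : ∀ B : Set (Euc d), MeasurableSet B → B ⊆ X → ∀ᵐ x : Euc d,
    Tendsto (fun V : Set (Euc d) => volume (V ∩ B) / volume V)
      (shrinkingTo x ⊓ 𝓟 {V | V ∈ 𝒱 ∧ x ∈ V}) (𝓝 (B.indicator 1 x))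

/-- The self-affine set of the system has positive measure and is differentiation regular. -/
def DifferentiationRegular (A : ι → Matrix (Fin d) (Fin d) ℝ) (t : ι → Euc d) : Prop :=
  0 < volume (selfAffineSet A t) ∧
  ∃ 𝒱 : Set (Set (Euc d)), IsDensityBasis 𝒱 (selfAffineSet A t) ∧
  ∃ η : ℝ, 0 < η ∧ ∀ x ∈ selfAffineSet A t, ∃ V : ℕ → Set (Euc d),
    (∀ j, V j ∈ 𝒱) ∧ (∀ j, x ∈ V j) ∧ Tendsto V atTop (shrinkingTo x) ∧
    ∀ j, ∃ w : List ι, w ≠ [] ∧ SWord A t w '' selfAffineSet A t ⊆ V j ∧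
      ENNReal.ofReal η * volume (V j) ≤ volume (SWord A t w '' selfAffineSet A t)

end Differentiation

section Facts

variable {d : ℕ} {ι : Type*} (A : ι → Matrix (Fin d) (Fin d) ℝ) (t : ι → Euc d)

theorem lin_mul (M N : Matrix (Fin d) (Fin d) ℝ) (x : Euc d) :
    lin (M * N) x = lin M (lin N x) := by
  simp [lin, map_mul]

theorem T_S {i : ι} (hi : (A i).det ≠ 0) (x : Euc d) : T A t i (S A t i x) = x := by
  unfold T S
  rw [add_sub_cancel_right, ← lin_mul, Matrix.nonsing_inv_mul _ (isUnit_iff_ne_zero.2 hi)]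
  simp [lin]

theorem S_T {i : ι} (hi : (A i).det ≠ 0) (x : Euc d) : S A t i (T A t i x) = x := by
  unfold T S
  rw [← lin_mul, Matrix.mul_nonsing_inv _ (isUnit_iff_ne_zero.2 hi)]
  simp [lin]

variable {A}

theorem exists_contraction_bound [Finite ι] (hA : ∀ i, ‖lin (A i)‖ < 1) :
    ∃ ρ : ℝ, 0 ≤ ρ ∧ ρ < 1 ∧ ∀ i, ‖lin (A i)‖ ≤ ρ := by
  cases nonempty_fintype ι
  rcases isEmpty_or_nonempty ι with h | h
  · exact ⟨0, le_rfl, one_pos, fun i => h.elim i⟩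
  · obtain ⟨k, hk⟩ := Finite.exists_max fun i => ‖lin (A i)‖
    exact ⟨_, norm_nonneg _, hA k, hk⟩

theorem norm_lin_prod_le {ρ : ℝ} (h0 : 0 ≤ ρ) (hρ : ∀ i, ‖lin (A i)‖ ≤ ρ) (i : ℕ → ι) (n : ℕ)
    (x : Euc d) : ‖lin (List.ofFn fun k : Fin n => A (i k)).prod x‖ ≤ ρ ^ n * ‖x‖ := by
  induction n generalizing i with
  | zero => simp [lin]
  | succ n ih =>
    rw [List.ofFn_succ, List.prod_cons, lin_mul]
    have := ih (fun k => i (k + 1))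
    calc _ ≤ ‖lin (A (i 0))‖ * ‖lin (List.ofFn fun k : Fin n => A (i (k + 1))).prod x‖ :=
          ContinuousLinearMap.le_opNorm _ _
      _ ≤ ρ * (ρ ^ n * ‖x‖) := by gcongr; exact hρ _
      _ = ρ ^ (n + 1) * ‖x‖ := by ring

theorem exists_term_bound [Finite ι] (hA : ∀ i, ‖lin (A i)‖ < 1) :
    ∃ u : ℕ → ℝ, Summable u ∧ ∀ (n : ℕ) (i : ℕ → ι),
      ‖lin (List.ofFn fun k : Fin n => A (i k)).prod (t (i n))‖ ≤ u n := by
  cases nonempty_fintype ι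
  obtain ⟨ρ, h0, h1, hρ⟩ := exists_contraction_bound hA
  refine ⟨fun n => ρ ^ n * ∑ i, ‖t i‖, (summable_geometric_of_lt_one h0 h1).mul_right _,
    fun n i => (norm_lin_prod_le h0 hρ i n _).trans
      (mul_le_mul_of_nonneg_left ?_ (pow_nonneg h0 n))⟩
  exact Finset.single_le_sum (f := fun i => ‖t i‖) (fun _ _ => norm_nonneg _) (Finset.mem_univ _)

theorem summable_projection [Finite ι] (hA : ∀ i, ‖lin (A i)‖ < 1) (i : ℕ → ι) :
    Summable fun n : ℕ => lin (List.ofFn fun k : Fin n => A (i k)).prod (t (i n)) := by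
  obtain ⟨u, hu, hb⟩ := exists_term_bound t hA
  exact Summable.of_norm_bounded hu fun n => hb n i

theorem tendsto_SWord_projection [Finite ι] (hA : ∀ i, ‖lin (A i)‖ < 1) (i : ℕ → ι) :
    Tendsto (fun n : ℕ => SWord A t (List.ofFn fun k : Fin n => i k) 0) atTop
      (𝓝 (projection A t i)) := by
  have key : ∀ (n : ℕ) (i : ℕ → ι), SWord A t (List.ofFn fun k : Fin n => i k) 0 =
      ∑ m ∈ Finset.range n, lin (List.ofFn fun k : Fin m => A (i k)).prod (t (i m)) := by
    intro n
    induction n with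
    | zero => intro i; simp [SWord]
    | succ n ih =>
      intro i
      have h := ih (fun k => i (k + 1))
      simp only [SWord] at h
      rw [Finset.sum_range_succ', SWord, List.ofFn_succ, List.foldr_cons]
      simp only [Fin.val_succ, Fin.val_zero]
      rw [h, S, map_sum]
      congr 1
      · refine Finset.sum_congr rfl fun m _ => ?_
        rw [List.ofFn_succ, List.prod_cons, lin_mul]
        simp
      · simp [lin]
  simp only [key]
  exact (summable_projection t hA i).hasSum.tendsto_sum_nat

theorem projection_shift [Finite ι] (hA : ∀ i, ‖lin (A i)‖ < 1) (i : ℕ → ι) :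
    projection A t i = S A t (i 0) (projection A t fun k => i (k + 1)) := by
  have hs := summable_projection t hA i
  have hs' := summable_projection t hA fun k => i (k + 1)
  rw [projection, hs.tsum_eq_zero_add, S, projection, ContinuousLinearMap.map_tsum _ hs', add_comm]
  congr 1
  · refine tsum_congr fun n => ?_
    rw [List.ofFn_succ, List.prod_cons, lin_mul]
    simp
  · simp [lin]

theorem isSelfAffineSet_range_projection [Finite ι] [Nonempty ι] (hA : ∀ i, ‖lin (A i)‖ < 1) :
    IsSelfAffineSet A t (range (projection A t)) := by
  let _ : TopologicalSpace ι := ⊥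
  have : DiscreteTopology ι := ⟨rfl⟩
  refine ⟨range_nonempty _, ?_, ?_⟩
  · obtain ⟨u, hu, hb⟩ := exists_term_bound t hA
    refine isCompact_range (continuous_tsum (fun n => ?_) hu hb)
    have h1 : Continuous fun (i : ℕ → ι) (k : Fin (n + 1)) => i k :=
      continuous_pi fun k => continuous_apply _
    have h2 : ∀ g : (Fin (n + 1) → ι) → Euc d,
        Continuous fun i : ℕ → ι => g fun k : Fin (n + 1) => i k :=
      fun g => (continuous_of_discreteTopology (f := g)).comp h1
    have h3 := h2 fun p => lin (List.ofFn fun k : Fin n => A (p k.castSucc)).prod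
      (t (p (Fin.last n)))
    simpa only [Fin.val_castSucc, Fin.val_last] using h3
  · ext x
    simp only [mem_range, mem_iUnion, mem_image, exists_exists_eq_and]
    constructor
    · rintro ⟨i, rfl⟩
      exact ⟨i 0, fun k => i (k + 1), (projection_shift t hA i).symm⟩
    · rintro ⟨k, i, rfl⟩
      obtain ⟨j, h0, hj⟩ : ∃ j : ℕ → ι, j 0 = k ∧ ∀ n, j (n + 1) = i n :=
        ⟨fun n => Nat.casesOn n k i, rfl, fun _ => rfl⟩
      exact ⟨j, by rw [projection_shift t hA, h0, funext hj]⟩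

theorem IsSelfAffineSet.subset [Finite ι] (hA : ∀ i, ‖lin (A i)‖ < 1) {X Y : Set (Euc d)}
    (hX : IsSelfAffineSet A t X) (hY : IsSelfAffineSet A t Y) : X ⊆ Y := by
  obtain ⟨ρ, h0, h1, hρ⟩ := exists_contraction_bound hA
  obtain ⟨x, hx, hmax⟩ := hX.2.1.exists_isMaxOn hX.1
    (Metric.continuous_infDist_pt Y).continuousOn
  have hx' := hx
  rw [hX.2.2] at hx'
  obtain ⟨i, y, hy, rfl⟩ := by simpa only [mem_iUnion, mem_image] using hx'
  obtain ⟨z, hz, hyz⟩ := hY.2.1.exists_infDist_eq_dist hY.1 y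
  have hSz : S A t i z ∈ Y := by
    rw [hY.2.2]
    exact mem_iUnion.2 ⟨i, z, hz, rfl⟩
  have hle : Metric.infDist (S A t i y) Y ≤ ρ * Metric.infDist (S A t i y) Y :=
    calc Metric.infDist (S A t i y) Y ≤ dist (S A t i y) (S A t i z) :=
          Metric.infDist_le_dist_of_mem hSz
      _ = ‖lin (A i) (y - z)‖ := by simp [S, dist_eq_norm]
      _ ≤ ρ * dist y z := by
          rw [dist_eq_norm]
          exact (ContinuousLinearMap.le_opNorm _ _).trans (by gcongr; exact hρ i)
      _ ≤ ρ * Metric.infDist (S A t i y) Y := by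
          rw [← hyz]
          gcongr
          exact hmax hy
  have hnn : 0 ≤ Metric.infDist (S A t i y) Y := Metric.infDist_nonneg
  have hz0 : Metric.infDist (S A t i y) Y = 0 := by nlinarith
  intro a ha
  refine (hY.2.1.isClosed.mem_iff_infDist_zero hY.1).2 (le_antisymm ?_ Metric.infDist_nonneg)
  exact (hmax ha).trans hz0.le

theorem existsUnique_isSelfAffineSet [Finite ι] [Nonempty ι] (hA : ∀ i, ‖lin (A i)‖ < 1) :
    ∃! X : Set (Euc d), IsSelfAffineSet A t X :=
  ⟨_, isSelfAffineSet_range_projection t hA, fun _ hY =>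
    (hY.subset t hA (isSelfAffineSet_range_projection t hA)).antisymm
      ((isSelfAffineSet_range_projection t hA).subset t hA hY)⟩

theorem isSelfAffineSet_selfAffineSet [Finite ι] [Nonempty ι] (hA : ∀ i, ‖lin (A i)‖ < 1) :
    IsSelfAffineSet A t (selfAffineSet A t) :=
  Classical.epsilon_spec (existsUnique_isSelfAffineSet t hA).exists

end Facts

end SelfAffine

open SelfAffine

/-!
The three assertions rest on one statement about translates of small sets. Attach to each nonempty
word `w` a sequence `w c_w` that starts with `w`, and a set `B_w` whose measure is comparable to
`|det A_w| / λ ^ n`, where `n` is the length of `w`. Let `U_n(t)` be the union, over the words of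
length `n`, of the sets `π_t(w c_w) + B_w` (`levelCover`). Then `limsup ℒ(U_n(t)) > 0` for almost
every `t` (`ae_limsup_levelCover_pos`).

The number `f_n(t, y)` of words of length `n` whose set contains `y` has an integral over `y` that
is bounded below, because the numbers `|det A_w|` of the words of length `n` add up to `λ ^ n`. By
Fatou's lemma and the Cauchy-Schwarz inequality (`ae_limsup_pos_of_second_moment`) it suffices to
bound the integral of `f_n ^ 2` over `y` and over `t` in a ball, uniformly in `n`. This integral
is a sum over pairs of words. If `v` is the longest common prefix of `w ≠ w'`, then
`π_t(w c_w) - π_t(w' c_w')` is the image under `A_v` of a linear function of `t`, and this function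
is uniformly invertible in one of the translations `t_j` because `‖A_i‖ < 1 / 2`
(`exists_le_norm_projection_single_sub`). Integrating over that `t_j` first shows that the pair
contributes at most a constant times `λ ^ (-2 n) |det A_w| |det A_w'| / |det A_v|`
(`lintegral_pair_le`), and the sum of these bounds over all pairs is geometric in the length of `v`
(`sum_overlapWeight_le`).

For the shrinking targets, `T_w y ∈ π(c) + E` says that `y ∈ π(w c) + A_w E`. For the recurrence,
`T_w y ∈ y + E` says that `y ∈ π(w w w ⋯) + (1 - A_w)⁻¹ A_w E`. In both cases the sets `B_w` shrink
to the origin, so that points in infinitely many `U_n(t)` belong to the closed set `X_t`; and these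
points form a set of measure at least `limsup ℒ(U_n(t))`, since the `U_n(t)` lie in a bounded set
(`volume_inter_frequently_levelCover_pos`).

For the assertion on balls, the union over `C` of the target sets has positive measure by the first
assertion, and each `S_i` maps it into itself. Under differentiation regularity such a subset of `X`
has full measure (`DifferentiationRegular.ae_mem`).
-/

namespace SelfAffine

/-! ### Determinants and words -/

section Words

variable {d : ℕ} {ι : Type*}

theorem det_lin (M : Matrix (Fin d) (Fin d) ℝ) :
    LinearMap.det (lin M : Euc d →ₗ[ℝ] Euc d) = M.det := by
  have h : (lin M : Euc d →ₗ[ℝ] Euc d) = Matrix.toLin (PiLp.basisFun 2 ℝ (Fin d))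
      (PiLp.basisFun 2 ℝ (Fin d)) M := by
    ext x k
    simp [lin, Matrix.toLin_apply, Matrix.mulVec, dotProduct, Pi.single_apply]
  rw [h, LinearMap.det_toLin]

/-- The image of the unit ball contains the ball of radius `c`. -/
theorem le_abs_det {f : Euc d →ₗ[ℝ] Euc d} {c : ℝ} (hc : 0 < c) (hf : ∀ x, c * ‖x‖ ≤ ‖f x‖) :
    c ^ d ≤ |LinearMap.det f| := by
  have hinj : Function.Injective f := by
    rw [← LinearMap.ker_eq_bot, LinearMap.ker_eq_bot']
    intro x hx
    have := hf x
    rw [hx, norm_zero] at this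
    exact norm_le_zero_iff.1 (by nlinarith [norm_nonneg x])
  have hsurj := LinearMap.surjective_of_injective hinj
  have hsub : Metric.ball (0 : Euc d) c ⊆ f '' Metric.ball 0 1 := by
    intro y hy
    obtain ⟨x, rfl⟩ := hsurj y
    refine ⟨x, ?_, rfl⟩
    rw [mem_ball_zero_iff] at hy ⊢
    nlinarith [hf x]
  have h := measure_mono (μ := (volume : Measure (Euc d))) hsub
  rw [Measure.addHaar_image_linearMap, Measure.addHaar_ball_of_pos _ _ hc,
    ENNReal.mul_le_mul_iff_left (Metric.measure_ball_pos _ _ one_pos).ne' measure_ball_lt_top.ne,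
    ENNReal.ofReal_le_ofReal_iff (abs_nonneg _)] at h
  simpa using h

/-- The image of the unit ball lies in the ball of radius `c`. -/
theorem abs_det_le {f : Euc d →ₗ[ℝ] Euc d} {c : ℝ} (hc : 0 < c) (hf : ∀ x, ‖f x‖ ≤ c * ‖x‖) :
    |LinearMap.det f| ≤ c ^ d := by
  have hsub : f '' Metric.ball 0 1 ⊆ Metric.ball (0 : Euc d) c := by
    rintro _ ⟨x, hx, rfl⟩
    rw [mem_ball_zero_iff] at hx ⊢
    nlinarith [hf x]
  have h := measure_mono (μ := (volume : Measure (Euc d))) hsub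
  rw [Measure.addHaar_image_linearMap, Measure.addHaar_ball_of_pos _ _ hc,
    ENNReal.mul_le_mul_iff_left (Metric.measure_ball_pos _ _ one_pos).ne' measure_ball_lt_top.ne,
    ENNReal.ofReal_le_ofReal_iff (pow_nonneg hc.le _)] at h
  simpa using h

/-- For the word `w = (i_1, …, i_n)`, the product `A_{i_1} ⋯ A_{i_n}`. -/
def wordProd (A : ι → Matrix (Fin d) (Fin d) ℝ) (w : List ι) : Matrix (Fin d) (Fin d) ℝ :=
  (w.map A).prod

/-- For the word `w = (i_1, …, i_n)`, the number `|det (A_{i_1} ⋯ A_{i_n})|`. -/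
noncomputable def wordDet (A : ι → Matrix (Fin d) (Fin d) ℝ) (w : List ι) : ℝ :=
  |(wordProd A w).det|

variable (A : ι → Matrix (Fin d) (Fin d) ℝ) (t : ι → Euc d)

theorem wordProd_cons (i : ι) (w : List ι) : wordProd A (i :: w) = A i * wordProd A w := by
  simp [wordProd]

theorem wordDet_nil : wordDet A [] = 1 := by simp [wordDet, wordProd]

theorem wordDet_cons (i : ι) (w : List ι) :
    wordDet A (i :: w) = |(A i).det| * wordDet A w := by
  simp [wordDet, wordProd_cons, Matrix.det_mul, abs_mul]

variable {A} in
theorem wordProd_det_ne_zero (hdet : ∀ i, (A i).det ≠ 0) (w : List ι) :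
    (wordProd A w).det ≠ 0 := by
  induction w with
  | nil => simp [wordProd]
  | cons i w ih => rw [wordProd_cons, Matrix.det_mul]; exact mul_ne_zero (hdet i) ih

variable {A} in
theorem wordDet_pos (hdet : ∀ i, (A i).det ≠ 0) (w : List ι) : 0 < wordDet A w :=
  abs_pos.2 (wordProd_det_ne_zero hdet w)

theorem lin_one (x : Euc d) : lin (1 : Matrix (Fin d) (Fin d) ℝ) x = x := by simp [lin]

variable {A} in
theorem norm_wordProd_le {ρ : ℝ} (h0 : 0 ≤ ρ) (hρ : ∀ i, ‖lin (A i)‖ ≤ ρ) (w : List ι)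
    (x : Euc d) : ‖lin (wordProd A w) x‖ ≤ ρ ^ w.length * ‖x‖ := by
  induction w with
  | nil => simp [wordProd, lin_one]
  | cons i w ih =>
    rw [wordProd_cons, lin_mul, List.length_cons]
    calc _ ≤ ‖lin (A i)‖ * ‖lin (wordProd A w) x‖ := ContinuousLinearMap.le_opNorm _ _
      _ ≤ ρ * (ρ ^ w.length * ‖x‖) := by gcongr; exact hρ _
      _ = ρ ^ (w.length + 1) * ‖x‖ := by ring

theorem SWord_eq (w : List ι) (x : Euc d) :
    SWord A t w x = lin (wordProd A w) x + SWord A t w 0 := by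
  induction w with
  | nil => simp [SWord, wordProd, lin_one]
  | cons i w ih =>
    have h : ∀ y, SWord A t (i :: w) y = lin (A i) (SWord A t w y) + t i := fun y => rfl
    rw [h, h, ih, map_add, wordProd_cons, lin_mul, add_assoc]

theorem SWord_sub (w : List ι) (x y : Euc d) :
    SWord A t w x - SWord A t w y = lin (wordProd A w) (x - y) := by
  rw [SWord_eq A t w x, SWord_eq A t w y, map_sub]
  abel

variable {A}

theorem lin_wordProd_inv (hdet : ∀ i, (A i).det ≠ 0) (w : List ι) (z : Euc d) :
    lin (wordProd A w) (lin (wordProd A w)⁻¹ z) = z := by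
  rw [← lin_mul, Matrix.mul_nonsing_inv _
    (isUnit_iff_ne_zero.2 (wordProd_det_ne_zero hdet w)), lin_one]

theorem lin_inv_wordProd (hdet : ∀ i, (A i).det ≠ 0) (w : List ι) (z : Euc d) :
    lin (wordProd A w)⁻¹ (lin (wordProd A w) z) = z := by
  rw [← lin_mul, Matrix.nonsing_inv_mul _
    (isUnit_iff_ne_zero.2 (wordProd_det_ne_zero hdet w)), lin_one]

theorem SWord_TWord (hdet : ∀ i, (A i).det ≠ 0) (w : List ι) (x : Euc d) :
    SWord A t w (TWord A t w x) = x := by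
  induction w generalizing x with
  | nil => rfl
  | cons i w ih =>
    change S A t i (SWord A t w (TWord A t w (T A t i x))) = x
    rw [ih, S_T A t (hdet i)]

theorem TWord_SWord (hdet : ∀ i, (A i).det ≠ 0) (w : List ι) (x : Euc d) :
    TWord A t w (SWord A t w x) = x := by
  induction w generalizing x with
  | nil => rfl
  | cons i w ih =>
    change TWord A t w (T A t i (S A t i (SWord A t w x))) = x
    rw [T_S A t (hdet i), ih]

theorem TWord_sub (hdet : ∀ i, (A i).det ≠ 0) (w : List ι) (x y : Euc d) :
    TWord A t w x - TWord A t w y = lin (wordProd A w)⁻¹ (x - y) := by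
  have h := SWord_sub A t w (TWord A t w x) (TWord A t w y)
  rw [SWord_TWord t hdet, SWord_TWord t hdet] at h
  rw [h, lin_inv_wordProd hdet]

theorem measurable_TWord (w : List ι) :
    Measurable (TWord A t w) := by
  induction w with
  | nil => exact measurable_id
  | cons i w ih =>
    exact ih.comp ((lin (A i)⁻¹).continuous.measurable.comp (measurable_id.sub_const _))

theorem SWord_mem_of_forall_S_mem {W : Set (Euc d)} (hW : ∀ i, ∀ y ∈ W, S A t i y ∈ W)
    (w : List ι) {y : Euc d} (hy : y ∈ W) : SWord A t w y ∈ W := by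
  induction w with
  | nil => exact hy
  | cons i w ih => exact hW i _ ih

theorem volume_preimage_lin_inv (hdet : ∀ i, (A i).det ≠ 0) (w : List ι) (E : Set (Euc d)) :
    volume (lin (wordProd A w)⁻¹ ⁻¹' E) = ENNReal.ofReal (wordDet A w) * volume E := by
  have h : LinearMap.det (lin (wordProd A w)⁻¹ : Euc d →ₗ[ℝ] Euc d) = (wordProd A w).det⁻¹ := by
    rw [det_lin, Matrix.det_nonsing_inv, Ring.inverse_eq_inv']
  have h0 := wordProd_det_ne_zero hdet w
  have := Measure.addHaar_preimage_linearMap (volume : Measure (Euc d))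
    (f := (lin (wordProd A w)⁻¹ : Euc d →ₗ[ℝ] Euc d)) (by rw [h]; exact inv_ne_zero h0) E
  rw [h, inv_inv] at this
  exact this

theorem volume_SWord_image (w : List ι) (E : Set (Euc d)) :
    volume (SWord A t w '' E) = ENNReal.ofReal (wordDet A w) * volume E := by
  have h : SWord A t w '' E = (fun x => x + SWord A t w 0) ''
      ((lin (wordProd A w) : Euc d →ₗ[ℝ] Euc d) '' E) := by
    rw [image_image]
    exact image_congr fun x _ => SWord_eq A t w x
  rw [h, image_add_right, measure_preimage_add_right, Measure.addHaar_image_linearMap, det_lin]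
  rfl

/-- The sequence that starts with the word `w` and goes on with the sequence `c`. -/
def prepend (w : List ι) (c : ℕ → ι) : ℕ → ι := Stream'.appendStream' w c

/-- The periodic sequence `w w w ⋯`. -/
theorem exists_prepend_eq_self {w : List ι} (hw : w ≠ []) : ∃ c : ℕ → ι, prepend w c = c :=
  ⟨Stream'.cycle w hw, (Stream'.cycle_eq w hw).symm⟩

theorem projection_prepend_cons [Finite ι] (hA : ∀ i, ‖lin (A i)‖ < 1) (i : ι) (w : List ι)
    (c : ℕ → ι) : projection A t (prepend (i :: w) c) = S A t i (projection A t (prepend w c)) :=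
  projection_shift t hA (prepend (i :: w) c)

theorem projection_prepend [Finite ι] (hA : ∀ i, ‖lin (A i)‖ < 1) (w : List ι)
    (c : ℕ → ι) : projection A t (prepend w c) = SWord A t w (projection A t c) := by
  induction w with
  | nil => rfl
  | cons i w ih => rw [projection_prepend_cons t hA, ih]; rfl

/-- For two words `w`, `w'` with longest common prefix `v`, the number
`|det A_w| |det A_{w'}| / |det A_v|`. It is defined by recursion on the first letters, and only used
for words of the same length. -/
noncomputable def overlapWeight [DecidableEq ι] (A : ι → Matrix (Fin d) (Fin d) ℝ) :
    List ι → List ι → ℝ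
  | i :: w, i' :: w' =>
    if i = i' then |(A i).det| * overlapWeight A w w' else wordDet A (i :: w) * wordDet A (i' :: w')
  | _, _ => 1

theorem overlapWeight_nonneg [DecidableEq ι] (w w' : List ι) : 0 ≤ overlapWeight A w w' := by
  induction w generalizing w' with
  | nil => simp [overlapWeight]
  | cons i w ih =>
    cases w' with
    | nil => simp [overlapWeight]
    | cons i' w' =>
      rw [overlapWeight]
      split_ifs
      · exact mul_nonneg (abs_nonneg _) (ih w')
      · exact mul_nonneg (abs_nonneg _) (abs_nonneg _)

end Words

/-! ### Transversality -/

section Transversality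

variable {d : ℕ} {ι : Type*} [Finite ι] {A : ι → Matrix (Fin d) (Fin d) ℝ}

/-- The projection of a fixed sequence, as a linear function of the translations. -/
noncomputable def projectionLin (hA : ∀ i, ‖lin (A i)‖ < 1) (i : ℕ → ι) :
    (ι → Euc d) →ₗ[ℝ] Euc d where
  toFun t := projection A t i
  map_add' s t := by
    simp only [projection, Pi.add_apply, map_add]
    exact (summable_projection s hA i).tsum_add (summable_projection t hA i)
  map_smul' c t := by
    simp only [projection, Pi.smul_apply, map_smul, RingHom.id_apply]
    exact (summable_projection t hA i).tsum_const_smul c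

theorem projectionLin_apply (hA : ∀ i, ‖lin (A i)‖ < 1) (i : ℕ → ι) (t : ι → Euc d) :
    projectionLin hA i t = projection A t i := rfl

theorem continuous_projection (hA : ∀ i, ‖lin (A i)‖ < 1) (i : ℕ → ι) :
    Continuous fun t : ι → Euc d => projection A t i :=
  (projectionLin hA i).continuous_of_finiteDimensional

variable [DecidableEq ι]

/-- With all translations but `t_j` equal to zero, only the positions of the sequence that carry the
letter `j` contribute to its projection. -/
theorem norm_projection_single_sub_le {ρ : ℝ} (h0 : 0 ≤ ρ) (h1 : ρ < 1)
    (hρ : ∀ i, ‖lin (A i)‖ ≤ ρ) (i : ℕ → ι) (j : ι) (x : Euc d) :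
    ‖projection A (Pi.single j x) i - (if i 0 = j then x else 0)‖ ≤
      (∑' n, if i (n + 1) = j then ρ ^ (n + 1) else 0) * ‖x‖ := by
  have hs := summable_projection (Pi.single j x) (fun i => (hρ i).trans_lt h1) i
  have hg : Summable fun n : ℕ => if i (n + 1) = j then ρ ^ (n + 1) else 0 := by
    refine Summable.of_nonneg_of_le (fun n => ?_) (fun n => ?_)
      ((summable_nat_add_iff 1).2 (summable_geometric_of_lt_one h0 h1))
    · split_ifs <;> positivity
    · split_ifs
      · exact le_rfl
      · positivity
  rw [projection, hs.tsum_eq_zero_add, ← tsum_mul_right]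
  have e : lin (List.ofFn fun k : Fin 0 => A (i k)).prod
      ((Pi.single j x : ι → Euc d) (i 0)) = if i 0 = j then x else 0 := by
    simp [lin_one, Pi.single_apply]
  rw [e, add_sub_cancel_left]
  refine tsum_of_norm_bounded (hg.mul_right _).hasSum fun n => ?_
  split_ifs with h
  · rw [h, Pi.single_eq_same]
    exact norm_lin_prod_le h0 hρ i (n + 1) x
  · simp [h]

/-- If two sequences start with different letters `a` and `b`, then the difference of their
projections depends in a nondegenerate way on `t_a` or on `t_b`. Each later position of a sequence
perturbs the coefficient of at most one of `t_a`, `t_b`, so that the two perturbations add up to at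
most `2 ∑ ρ ^ n`, and the smaller one is at most half of this. -/
theorem exists_le_norm_projection_single_sub {ρ : ℝ} (h0 : 0 ≤ ρ) (h1 : ρ < 1 / 2)
    (hρ : ∀ i, ‖lin (A i)‖ ≤ ρ) {i i' : ℕ → ι} (hi : i 0 ≠ i' 0) :
    ∃ j, ∀ x : Euc d, (1 - ρ / (1 - ρ)) * ‖x‖ ≤
      ‖projection A (Pi.single j x) i - projection A (Pi.single j x) i'‖ := by
  have h1' : ρ < 1 := by linarith
  let s : (ℕ → ι) → ι → ℝ := fun i j => ∑' n, if i (n + 1) = j then ρ ^ (n + 1) else 0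
  have hg : Summable fun n : ℕ => ρ ^ (n + 1) :=
    (summable_nat_add_iff 1).2 (summable_geometric_of_lt_one h0 h1')
  have hsum : ∑' n : ℕ, ρ ^ (n + 1) = ρ / (1 - ρ) := by
    simp_rw [pow_succ]
    rw [tsum_mul_right, tsum_geometric_of_lt_one h0 h1']
    ring
  have hs : ∀ (i : ℕ → ι) (j : ι),
      Summable fun n : ℕ => if i (n + 1) = j then ρ ^ (n + 1) else 0 := by
    intro i j
    refine Summable.of_nonneg_of_le (fun n => ?_) (fun n => ?_) hg
    · split_ifs <;> positivity
    · split_ifs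
      · exact le_rfl
      · positivity
  have hab : ∀ u : ℕ → ι, s u (i 0) + s u (i' 0) ≤ ρ / (1 - ρ) := by
    intro u
    rw [← hsum, ← (hs u _).tsum_add (hs u _)]
    refine ((hs u _).add (hs u _)).tsum_le_tsum (fun n => ?_) hg
    have := pow_nonneg h0 (n + 1)
    by_cases h : u (n + 1) = i 0
    · simp [h, hi]
    · split_ifs <;> simp [this]
  have hone : ∃ j, (j = i 0 ∨ j = i' 0) ∧ s i j + s i' j ≤ ρ / (1 - ρ) := by
    by_contra! h
    have h3 := h _ (Or.inl rfl)
    have h4 := h _ (Or.inr rfl)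
    linarith [hab i, hab i']
  obtain ⟨j, hj, hjs⟩ := hone
  refine ⟨j, fun x => ?_⟩
  have e1 := norm_projection_single_sub_le h0 h1' hρ i j x
  have e2 := norm_projection_single_sub_le h0 h1' hρ i' j x
  have e3 : ‖(if i 0 = j then x else 0) - (if i' 0 = j then x else 0)‖ = ‖x‖ := by
    rcases hj with rfl | rfl
    · simp [hi.symm]
    · simp [hi]
  set p := projection A (Pi.single j x) i
  set p' := projection A (Pi.single j x) i'
  set a := (if i 0 = j then x else 0)
  set b := (if i' 0 = j then x else 0)
  have e4 : ‖a - b‖ ≤ ‖p - p'‖ + ‖p - a‖ + ‖p' - b‖ := by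
    have : a - b = (p - p') - (p - a) + (p' - b) := by abel
    rw [this]
    exact (norm_add_le _ _).trans (by gcongr; exact norm_sub_le _ _)
  have e5 : (s i j + s i' j) * ‖x‖ ≤ ρ / (1 - ρ) * ‖x‖ := by gcongr
  change ‖p - a‖ ≤ s i j * ‖x‖ at e1
  change ‖p' - b‖ ≤ s i' j * ‖x‖ at e2
  linarith

/-- The difference of the projections of two sequences, restricted to translations supported at
the letter `j`. -/
noncomputable def diffAt (hA : ∀ i, ‖lin (A i)‖ < 1) (i i' : ℕ → ι) (j : ι) :
    Euc d →ₗ[ℝ] Euc d :=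
  (projectionLin hA i - projectionLin hA i') ∘ₗ LinearMap.single ℝ (fun _ => Euc d) j

/-- Two sequences that extend different words `w`, `w'` of the same length have projections whose
difference depends on some translation `t_j` with a determinant of order at least that of the common
prefix. -/
theorem exists_le_overlapWeight_mul_det {ρ : ℝ} (h0 : 0 ≤ ρ) (h1 : ρ < 1 / 2)
    (hρ : ∀ i, ‖lin (A i)‖ ≤ ρ) (hA : ∀ i, ‖lin (A i)‖ < 1) {w w' : List ι}
    (hlen : w.length = w'.length) (hw : w ≠ w') (c c' : ℕ → ι) :
    ∃ j, (1 - ρ / (1 - ρ)) ^ d * (wordDet A w * wordDet A w') ≤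
      overlapWeight A w w' * |LinearMap.det (diffAt hA (prepend w c) (prepend w' c') j)| := by
  induction w generalizing w' with
  | nil => exact absurd (List.length_eq_zero_iff.1 hlen.symm).symm hw
  | cons i w ih =>
    obtain _ | ⟨i', w'⟩ := w'
    · simp at hlen
    rw [overlapWeight]
    split_ifs with h
    · subst h
      obtain ⟨j, hj⟩ := ih (by simpa using hlen) (by simpa using hw)
      refine ⟨j, ?_⟩
      have hcomp : diffAt hA (prepend (i :: w) c) (prepend (i :: w') c') j =
          (lin (A i) : Euc d →ₗ[ℝ] Euc d) ∘ₗ diffAt hA (prepend w c) (prepend w' c') j := by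
        refine LinearMap.ext fun x => ?_
        simp only [diffAt, LinearMap.comp_apply, LinearMap.sub_apply, projectionLin_apply,
          projection_prepend_cons _ hA]
        simp [S]
      rw [hcomp, LinearMap.det_comp, det_lin, abs_mul, wordDet_cons, wordDet_cons]
      have := mul_le_mul_of_nonneg_left hj (mul_nonneg (abs_nonneg (A i).det)
        (abs_nonneg (A i).det))
      linarith
    · obtain ⟨j, hj⟩ := exists_le_norm_projection_single_sub (A := A) h0 h1 hρ
        (i := prepend (i :: w) c) (i' := prepend (i' :: w') c') h
      refine ⟨j, ?_⟩
      have hpos : 0 < 1 - ρ / (1 - ρ) := by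
        rw [sub_pos, div_lt_one] <;> linarith
      rw [mul_comm]
      exact mul_le_mul_of_nonneg_left (le_abs_det hpos hj)
        (mul_nonneg (abs_nonneg _) (abs_nonneg _))

end Transversality

/-! ### Sums over words -/

section Sums

variable {d : ℕ} {ι : Type*} [Fintype ι] (A : ι → Matrix (Fin d) (Fin d) ℝ)

theorem sum_word_succ {M : Type*} [AddCommMonoid M] (n : ℕ) (f : List ι → M) :
    ∑ w : Fin (n + 1) → ι, f (List.ofFn w) =
      ∑ i, ∑ w : Fin n → ι, f (i :: List.ofFn w) := by
  rw [← Fintype.sum_prod_type', ← (Fin.consEquiv fun _ => ι).sum_comp]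
  simp [Fin.consEquiv]

theorem sum_wordDet (n : ℕ) : ∑ w : Fin n → ι, wordDet A (List.ofFn w) = detSum A ^ n := by
  induction n with
  | zero => simp [wordDet_nil]
  | succ n ih =>
    rw [sum_word_succ]
    simp_rw [wordDet_cons, ← Finset.mul_sum, ih, ← Finset.sum_mul]
    rw [pow_succ', detSum]

variable {A}

/-- Adding a letter multiplies the sum over the pairs with the same first letter by `λ`, and
the pairs with different first letters contribute at most `λ ^ (2 n + 2)`. -/
theorem sum_overlapWeight_le [DecidableEq ι] (hlam : 1 < detSum A) (n : ℕ) :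
    ∑ w : Fin n → ι, ∑ w' : Fin n → ι, overlapWeight A (List.ofFn w) (List.ofFn w') ≤
      detSum A / (detSum A - 1) * detSum A ^ (2 * n) := by
  induction n with
  | zero =>
    simp only [Finset.univ_unique, Finset.sum_singleton, List.ofFn_zero, overlapWeight]
    rw [mul_zero, pow_zero, mul_one, one_le_div] <;> linarith
  | succ n ih =>
    set L := detSum A
    set G := ∑ w : Fin n → ι, ∑ w' : Fin n → ι, overlapWeight A (List.ofFn w) (List.ofFn w')
    have key : ∀ i i' : ι, ∑ w : Fin n → ι, ∑ w' : Fin n → ι,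
        overlapWeight A (i :: List.ofFn w) (i' :: List.ofFn w') ≤
        (if i = i' then |(A i).det| * G else 0) + |(A i).det| * |(A i').det| * L ^ (2 * n) := by
      intro i i'
      by_cases h : i = i'
      · simp only [overlapWeight, h, if_true, ← Finset.mul_sum]
        exact le_add_of_nonneg_right (mul_nonneg (mul_nonneg (abs_nonneg _) (abs_nonneg _))
          (pow_nonneg (by linarith) _))
      · simp only [overlapWeight, h, if_false, zero_add, ← Finset.mul_sum, ← Finset.sum_mul,
          wordDet_cons, sum_wordDet]
        exact (by ring : _ = _).le
    calc _ = ∑ i, ∑ i', ∑ w : Fin n → ι, ∑ w' : Fin n → ι,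
          overlapWeight A (i :: List.ofFn w) (i' :: List.ofFn w') := by
          rw [sum_word_succ n fun v => ∑ w' : Fin (n + 1) → ι, overlapWeight A v (List.ofFn w')]
          simp_rw [fun v => sum_word_succ n fun v' => overlapWeight A v v']
          exact Finset.sum_congr rfl fun i _ => Finset.sum_comm
      _ ≤ ∑ i, ∑ i', ((if i = i' then |(A i).det| * G else 0) +
            |(A i).det| * |(A i').det| * L ^ (2 * n)) :=
          Finset.sum_le_sum fun i _ => Finset.sum_le_sum fun i' _ => key i i'
      _ = L * G + L * L * L ^ (2 * n) := by
          simp only [Finset.sum_add_distrib, Finset.sum_ite_eq, Finset.mem_univ, if_true,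
            ← Finset.sum_mul, ← Finset.mul_sum]
          rfl
      _ ≤ L * (L / (L - 1) * L ^ (2 * n)) + L * L * L ^ (2 * n) := by
          gcongr
      _ = L / (L - 1) * L ^ (2 * (n + 1)) := by
          have : L - 1 ≠ 0 := by linarith
          field_simp
          ring

end Sums

/-! ### Overlaps of two translated sets -/

section Overlap

variable {d : ℕ} {ι : Type*} [Fintype ι]

theorem ball_eq_univ_pi_ball {R : ℝ} (hR : 0 < R) :
    Metric.ball (0 : ι → Euc d) R = Set.pi univ fun _ => Metric.ball 0 R :=
  ball_pi _ hR

/-- A linear map `D` that is invertible in one of the coordinates of a product space is integrated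
in that coordinate first. -/
theorem volume_ball_inter_preimage_le [DecidableEq ι] (D : (ι → Euc d) →ₗ[ℝ] Euc d) {j : ι}
    (hD : LinearMap.det (D ∘ₗ LinearMap.single ℝ (fun _ => Euc d) j) ≠ 0) {R : ℝ} (hR : 0 < R)
    {B : Set (Euc d)} (hB : MeasurableSet B) (z : Euc d) :
    ∫⁻ t in Metric.ball (0 : ι → Euc d) R, B.indicator (1 : Euc d → ℝ≥0∞) (z + D t) ≤
      volume (Metric.ball (0 : ι → Euc d) R) / volume (Metric.ball (0 : Euc d) R) *
        (ENNReal.ofReal |(LinearMap.det (D ∘ₗ LinearMap.single ℝ (fun _ => Euc d) j))⁻¹| *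
          volume B) := by
  set M := D ∘ₗ LinearMap.single ℝ (fun _ => Euc d) j with hM
  set K := ENNReal.ofReal |(LinearMap.det M)⁻¹| * volume B with hK
  have hv0 : volume (Metric.ball (0 : Euc d) R) ≠ 0 := (Metric.measure_ball_pos _ _ hR).ne'
  have hvt : volume (Metric.ball (0 : Euc d) R) ≠ ⊤ := measure_ball_lt_top.ne
  have hDm : Measurable D := D.continuous_of_finiteDimensional.measurable
  have hind : Measurable (B.indicator (1 : Euc d → ℝ≥0∞)) := measurable_one.indicator hB
  have hbox : MeasurableSet (Metric.ball (0 : ι → Euc d) R) := measurableSet_ball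
  calc _ = ∫⁻ t, (Metric.ball (0 : ι → Euc d) R).indicator
        (fun t => B.indicator (1 : Euc d → ℝ≥0∞) (z + D t)) t := (lintegral_indicator hbox _).symm
    -- In the coordinate `j`, the function on the right has the same integral as the bound for the
    -- one on the left, and integrating it over the other coordinates is immediate.
    _ ≤ ∫⁻ t, (Metric.ball (0 : ι → Euc d) R).indicator
        (fun _ => K / volume (Metric.ball (0 : Euc d) R)) t := by
      rw [volume_pi]
      refine lintegral_le_of_lmarginal_le (μ := fun _ : ι => (volume : Measure (Euc d))) {j}
        ((hind.comp (by fun_prop)).indicator hbox) (measurable_const.indicator hbox) fun x => ?_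
      rw [lmarginal_singleton, lmarginal_singleton]
      have hmem : ∀ ξ, Function.update x j ξ ∈ Metric.ball (0 : ι → Euc d) R ↔
          ξ ∈ Metric.ball (0 : Euc d) R ∧ ∀ k, k ≠ j → x k ∈ Metric.ball (0 : Euc d) R := by
        intro ξ
        rw [ball_eq_univ_pi_ball hR, Set.mem_univ_pi]
        constructor
        · intro h
          refine ⟨by simpa using h j, fun k hk => by simpa [hk] using h k⟩
        · rintro ⟨h1, h2⟩ k
          by_cases hk : k = j
          · subst hk; simpa using h1
          · simpa [hk] using h2 k hk
      by_cases hx : ∀ k, k ≠ j → x k ∈ Metric.ball (0 : Euc d) R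
      · have hup : ∀ ξ, z + D (Function.update x j ξ) = (z + D (Function.update x j 0)) + M ξ := by
          intro ξ
          have : Function.update x j ξ = Function.update x j 0 + Pi.single j ξ := by
            ext k : 1
            by_cases hk : k = j
            · subst hk; simp
            · simp [hk]
          rw [this, map_add, add_assoc]
          rfl
        calc ∫⁻ ξ, (Metric.ball (0 : ι → Euc d) R).indicator
              (fun t => B.indicator (1 : Euc d → ℝ≥0∞) (z + D t)) (Function.update x j ξ)
            ≤ ∫⁻ ξ, (M ⁻¹' ((fun y => (z + D (Function.update x j 0)) + y) ⁻¹' B)).indicator 1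
                ξ := by
              refine lintegral_mono fun ξ => ?_
              refine (indicator_le_self _ _ _).trans ?_
              rw [hup ξ]
              exact le_rfl
          _ ≤ K := by
              refine (lintegral_indicator_one_le _).trans ?_
              rw [Measure.addHaar_preimage_linearMap _ hD, measure_preimage_add]
          _ = ∫⁻ ξ, (Metric.ball (0 : Euc d) R).indicator
                (fun _ => K / volume (Metric.ball (0 : Euc d) R)) ξ := by
              rw [lintegral_indicator_const measurableSet_ball, ENNReal.div_mul_cancel hv0 hvt]
          _ ≤ _ := by
              refine lintegral_mono fun ξ => ?_
              by_cases hξ : ξ ∈ Metric.ball (0 : Euc d) R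
              · simp only [indicator_of_mem hξ, indicator_of_mem ((hmem ξ).2 ⟨hξ, hx⟩), le_rfl]
              · simp only [indicator_of_notMem hξ, zero_le]
      · have : ∀ ξ, Function.update x j ξ ∉ Metric.ball (0 : ι → Euc d) R :=
          fun ξ h => hx ((hmem ξ).1 h).2
        simp [indicator_of_notMem (this _)]
    _ = _ := by
      rw [lintegral_indicator_const hbox, ENNReal.div_eq_inv_mul, ENNReal.div_eq_inv_mul]
      ring

/-- The overlap of `p t + B` and `p' t + B'`, averaged over `t`. After a translation by `p t` it
only depends on `t` through `(p - p') t`, and the integral over `t` can be taken first. -/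
theorem lintegral_overlap_le [DecidableEq ι] (p p' : (ι → Euc d) →ₗ[ℝ] Euc d) {j : ι}
    (hD : LinearMap.det ((p - p') ∘ₗ LinearMap.single ℝ (fun _ => Euc d) j) ≠ 0) {R : ℝ}
    (hR : 0 < R) {B B' : Set (Euc d)} (hB : MeasurableSet B) (hB' : MeasurableSet B') :
    ∫⁻ t in Metric.ball (0 : ι → Euc d) R, ∫⁻ y,
        B.indicator (1 : Euc d → ℝ≥0∞) (y - p t) * B'.indicator (1 : Euc d → ℝ≥0∞) (y - p' t) ≤
      volume (Metric.ball (0 : ι → Euc d) R) / volume (Metric.ball (0 : Euc d) R) *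
        (ENNReal.ofReal |(LinearMap.det ((p - p') ∘ₗ LinearMap.single ℝ (fun _ => Euc d) j))⁻¹| *
          volume B') * volume B := by
  have hpm : Measurable p := p.continuous_of_finiteDimensional.measurable
  have hpm' : Measurable p' := p'.continuous_of_finiteDimensional.measurable
  have hi : Measurable (B.indicator (1 : Euc d → ℝ≥0∞)) := measurable_one.indicator hB
  have hi' : Measurable (B'.indicator (1 : Euc d → ℝ≥0∞)) := measurable_one.indicator hB'
  have hshift : ∀ t, ∫⁻ y, B.indicator (1 : Euc d → ℝ≥0∞) (y - p t) *
      B'.indicator (1 : Euc d → ℝ≥0∞) (y - p' t) =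
      ∫⁻ z, B.indicator (1 : Euc d → ℝ≥0∞) z *
        B'.indicator (1 : Euc d → ℝ≥0∞) (z + (p - p') t) := by
    intro t
    rw [← lintegral_add_right_eq_self _ (p t)]
    refine lintegral_congr fun z => ?_
    rw [add_sub_cancel_right, LinearMap.sub_apply, add_sub_assoc]
  simp_rw [hshift]
  rw [lintegral_lintegral_swap]
  · calc _ ≤ ∫⁻ z, B.indicator (1 : Euc d → ℝ≥0∞) z *
          (volume (Metric.ball (0 : ι → Euc d) R) / volume (Metric.ball (0 : Euc d) R) *
            (ENNReal.ofReal |(LinearMap.det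
              ((p - p') ∘ₗ LinearMap.single ℝ (fun _ => Euc d) j))⁻¹| * volume B')) := by
          refine lintegral_mono fun z => ?_
          have hm : Measurable fun t => B'.indicator (1 : Euc d → ℝ≥0∞) (z + (p - p') t) :=
            hi'.comp (measurable_const.add (hpm.sub hpm'))
          rw [lintegral_const_mul _ hm]
          exact mul_le_mul_right (volume_ball_inter_preimage_le (p - p') hD hR hB' z) _
      _ = _ := by
          rw [lintegral_mul_const _ hi, lintegral_indicator_one hB, mul_comm]
  · refine Measurable.aemeasurable ?_
    refine (hi.comp measurable_snd).mul (hi'.comp (measurable_snd.add ?_))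
    exact ((hpm.comp measurable_fst).sub (hpm'.comp measurable_fst))

end Overlap

/-! ### The second moment method -/

section SecondMomentMethod

variable {T α : Type*} [MeasurableSpace T] [MeasurableSpace α] {μ : Measure T} {ν : Measure α}

/-- The Cauchy-Schwarz inequality for `f` and the indicator function of its support. -/
theorem sq_lintegral_le {f : α → ℝ≥0∞} (hf : Measurable f) :
    (∫⁻ y, f y ∂ν) ^ 2 ≤ (∫⁻ y, f y ^ 2 ∂ν) * ν {y | f y ≠ 0} := by
  have hs : MeasurableSet {y | f y ≠ 0} := (hf (measurableSet_singleton 0)).compl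
  have h := ENNReal.lintegral_mul_le_Lp_mul_Lq ν Real.HolderConjugate.two_two hf.aemeasurable
    ((measurable_one (α := ℝ≥0∞)).indicator hs).aemeasurable
  have e1 : ∀ y, (f * {y | f y ≠ 0}.indicator (1 : α → ℝ≥0∞)) y = f y := by
    intro y
    by_cases hy : f y = 0 <;> simp [hy]
  have e2 : ∀ y, ({y | f y ≠ 0}.indicator (1 : α → ℝ≥0∞) y) ^ (2 : ℝ) =
      {y | f y ≠ 0}.indicator (1 : α → ℝ≥0∞) y := by
    intro y
    by_cases hy : f y = 0 <;> simp [hy]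
  rw [lintegral_congr e1, lintegral_congr e2] at h
  rw [lintegral_indicator_one hs] at h
  calc _ ≤ ((∫⁻ y, f y ^ (2 : ℝ) ∂ν) ^ (1 / (2 : ℝ)) * ν {y | f y ≠ 0} ^ (1 / (2 : ℝ))) ^ 2 := by
        gcongr
    _ = _ := by
        simp_rw [ENNReal.rpow_two]
        rw [mul_pow, ← ENNReal.rpow_natCast, ← ENNReal.rpow_natCast, ← ENNReal.rpow_mul,
          ← ENNReal.rpow_mul]
        norm_num

/-- If the functions `f_n(t, ·)` have integrals bounded below, and second moments bounded on average
over `t`, then for almost every `t` the supports of the functions `f_n(t, ·)` do not become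
negligible: by Fatou's lemma the second moments stay bounded along a subsequence that may depend on
`t`, and the Cauchy-Schwarz inequality bounds the measures of the supports along it. -/
theorem ae_limsup_pos_of_second_moment {f : ℕ → T → α → ℝ≥0∞} [SFinite ν]
    (hf : ∀ n, Measurable (Function.uncurry (f n))) {c K : ℝ≥0∞} (hc0 : c ≠ 0)
    (hK : K ≠ ⊤) (hmass : ∀ n t, c ≤ ∫⁻ y, f n t y ∂ν)
    (hsq : ∀ n, ∫⁻ t, ∫⁻ y, f n t y ^ 2 ∂ν ∂μ ≤ K) :
    ∀ᵐ t ∂μ, 0 < limsup (fun n => ν {y | f n t y ≠ 0}) atTop := by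
  have hm : ∀ n, Measurable fun t => ∫⁻ y, f n t y ^ 2 ∂ν := fun n =>
    ((hf n).pow_const 2).lintegral_prod_right'
  have h1 : ∫⁻ t, liminf (fun n => ∫⁻ y, f n t y ^ 2 ∂ν) atTop ∂μ ≤ K :=
    (lintegral_liminf_le hm).trans <| (liminf_le_liminf (Eventually.of_forall hsq)).trans (by simp)
  filter_upwards [ae_lt_top (Measurable.liminf hm) (h1.trans_lt hK.lt_top).ne] with t ht
  obtain ⟨b, hb1, hb2⟩ := exists_between ht
  have hfreq := frequently_lt_of_liminf_lt (h := hb1)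
  have hb0 : b ≠ 0 := (pos_of_gt hb1).ne'
  have hpos : 0 < c ^ 2 / b := ENNReal.div_pos (pow_ne_zero 2 hc0) hb2.ne
  refine hpos.trans_le (le_limsup_of_frequently_le' (hfreq.mono fun n hn => ?_))
  refine ENNReal.div_le_of_le_mul' ?_
  calc c ^ 2 ≤ (∫⁻ y, f n t y ∂ν) ^ 2 := by gcongr; exact hmass n t
    _ ≤ (∫⁻ y, f n t y ^ 2 ∂ν) * ν {y | f n t y ≠ 0} :=
      sq_lintegral_le ((hf n).comp measurable_prodMk_left)
    _ ≤ _ := by gcongr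

end SecondMomentMethod

/-! ### Limsup sets of coded targets -/

theorem ofFn_ne_nil {ι : Type*} {n : ℕ} (w : Fin (n + 1) → ι) : List.ofFn w ≠ [] := by
  rw [List.ofFn_succ]; exact List.cons_ne_nil _ _

section Cover

variable {d : ℕ} {ι : Type*} [Fintype ι]

/-- A family of sets `B_w`, indexed by the nonempty words `w`, whose measures are comparable to
`|det A_w| / λ ^ n`, where `n` is the length of `w`. -/
structure IsWordTarget (A : ι → Matrix (Fin d) (Fin d) ℝ) (B : List ι → Set (Euc d))
    (a b : ℝ) : Prop where
  measurable : ∀ w, w ≠ [] → MeasurableSet (B w)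
  le_volume : ∀ w, w ≠ [] → ENNReal.ofReal (a * (wordDet A w / detSum A ^ w.length)) ≤ volume (B w)
  volume_le : ∀ w, w ≠ [] → volume (B w) ≤ ENNReal.ofReal (b * (wordDet A w / detSum A ^ w.length))

/-- The union, over the words `w` of length `n`, of the translate of `B_w` by the projection of a
sequence that starts with `w` and goes on with `c_w`. -/
def levelCover (A : ι → Matrix (Fin d) (Fin d) ℝ) (t : ι → Euc d) (c : List ι → ℕ → ι)
    (B : List ι → Set (Euc d)) (n : ℕ) : Set (Euc d) :=
  {y | ∃ w : List ι, w.length = n ∧ y - projection A t (prepend w (c w)) ∈ B w}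

/-- The number of words `w` of length `n` for which `y` lies in the piece of `levelCover`
belonging to `w`. -/
noncomputable def levelCount (A : ι → Matrix (Fin d) (Fin d) ℝ) (c : List ι → ℕ → ι)
    (B : List ι → Set (Euc d)) (n : ℕ) (t : ι → Euc d) (y : Euc d) : ℝ≥0∞ :=
  ∑ w : Fin n → ι, (B (List.ofFn w)).indicator 1
    (y - projection A t (prepend (List.ofFn w) (c (List.ofFn w))))

variable {A : ι → Matrix (Fin d) (Fin d) ℝ} {c : List ι → ℕ → ι} {B : List ι → Set (Euc d)}
  {a b : ℝ}

theorem setOf_levelCount_ne_zero (n : ℕ) (t : ι → Euc d) :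
    {y | levelCount A c B n t y ≠ 0} = levelCover A t c B n := by
  ext y
  simp only [levelCount, levelCover, mem_ofPred_eq, ne_eq, Finset.sum_eq_zero_iff, not_forall,
    Finset.mem_univ, true_implies, indicator_apply_eq_zero, Pi.one_apply, one_ne_zero, imp_false,
    not_not]
  constructor
  · rintro ⟨w, hw⟩
    exact ⟨_, List.length_ofFn, hw⟩
  · rintro ⟨w, rfl, hw⟩
    exact ⟨w.get, by simpa only [List.ofFn_get] using hw⟩

theorem measurable_levelCount (hA : ∀ i, ‖lin (A i)‖ < 1) (hB : IsWordTarget A B a b) (n : ℕ) :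
    Measurable (Function.uncurry (levelCount A c B (n + 1))) := by
  refine Finset.measurable_sum _ fun w _ => ?_
  refine (measurable_one.indicator (hB.measurable _ (ofFn_ne_nil w))).comp ?_
  exact measurable_snd.sub ((continuous_projection hA _).measurable.comp measurable_fst)

theorem sum_ofReal_wordDet (hlam : 1 < detSum A) (ha : 0 ≤ a) (n : ℕ) :
    ∑ w : Fin n → ι, ENNReal.ofReal (a * (wordDet A (List.ofFn w) / detSum A ^ n)) =
      ENNReal.ofReal a := by
  have h0 : 0 < detSum A ^ n := pow_pos (by linarith) n
  have hnn : ∀ w ∈ (Finset.univ : Finset (Fin n → ι)),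
      0 ≤ a * (wordDet A (List.ofFn w) / detSum A ^ n) := fun w _ =>
    mul_nonneg ha (div_nonneg (abs_nonneg _) h0.le)
  rw [← ENNReal.ofReal_sum_of_nonneg hnn, ← Finset.mul_sum, ← Finset.sum_div,
    sum_wordDet, div_self h0.ne', mul_one]

theorem sum_ofReal_overlapWeight_le [DecidableEq ι] (hlam : 1 < detSum A) {q : ℝ} (hq : 0 ≤ q)
    (n : ℕ) :
    ∑ w : Fin n → ι, ∑ w' : Fin n → ι, ENNReal.ofReal
      (q * (overlapWeight A (List.ofFn w) (List.ofFn w') / detSum A ^ (2 * n))) ≤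
      ENNReal.ofReal (q * (detSum A / (detSum A - 1))) := by
  have h0 : 0 < detSum A ^ (2 * n) := pow_pos (by linarith) _
  have hnn : ∀ w w' : Fin n → ι,
      0 ≤ q * (overlapWeight A (List.ofFn w) (List.ofFn w') / detSum A ^ (2 * n)) := fun w w' =>
    mul_nonneg hq (div_nonneg (overlapWeight_nonneg _ _) h0.le)
  simp_rw [← ENNReal.ofReal_sum_of_nonneg fun w' (_ : w' ∈ (Finset.univ : Finset (Fin n → ι))) =>
    hnn _ w']
  rw [← ENNReal.ofReal_sum_of_nonneg fun w _ => Finset.sum_nonneg fun w' _ => hnn w w']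
  refine ENNReal.ofReal_le_ofReal ?_
  simp_rw [← Finset.mul_sum, ← Finset.sum_div]
  refine mul_le_mul_of_nonneg_left ?_ hq
  rw [div_le_iff₀ h0]
  exact sum_overlapWeight_le hlam n

theorem lintegral_indicator_sub {S : Set (Euc d)} (hS : MeasurableSet S) (p : Euc d) :
    ∫⁻ y, S.indicator (1 : Euc d → ℝ≥0∞) (y - p) = volume S := by
  rw [lintegral_sub_right_eq_self (fun y => S.indicator (1 : Euc d → ℝ≥0∞) y) p,
    lintegral_indicator_one hS]

theorem le_lintegral_levelCount (hlam : 1 < detSum A) (ha : 0 ≤ a)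
    (hB : IsWordTarget A B a b) (n : ℕ) (t : ι → Euc d) :
    ENNReal.ofReal a ≤ ∫⁻ y, levelCount A c B (n + 1) t y := by
  unfold levelCount
  have hm : ∀ w ∈ (Finset.univ : Finset (Fin (n + 1) → ι)), Measurable fun y =>
      (B (List.ofFn w)).indicator (1 : Euc d → ℝ≥0∞)
        (y - projection A t (prepend (List.ofFn w) (c (List.ofFn w)))) := fun w _ =>
    (measurable_one.indicator (hB.measurable _ (ofFn_ne_nil w))).comp (measurable_id.sub_const _)
  rw [lintegral_finsetSum _ hm, ← sum_ofReal_wordDet hlam ha (n + 1)]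
  refine Finset.sum_le_sum fun w _ => ?_
  have h := hB.le_volume _ (ofFn_ne_nil w)
  rw [List.length_ofFn] at h
  exact h.trans (lintegral_indicator_sub (hB.measurable _ (ofFn_ne_nil w)) _).ge

/-- The pieces of two words overlap on average over the translations as if they were independent, up
to the loss of the determinant of the common prefix. -/
theorem lintegral_pair_le [DecidableEq ι] {ρ : ℝ} (h0 : 0 ≤ ρ) (h1 : ρ < 1 / 2)
    (hρ : ∀ i, ‖lin (A i)‖ ≤ ρ) (hdet : ∀ i, (A i).det ≠ 0) (hlam : 1 < detSum A) (hb : 0 ≤ b)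
    (hB : IsWordTarget A B a b) {R : ℝ} (hR : 0 < R) (c c' : ℕ → ι) {w w' : List ι}
    (hlen : w.length = w'.length) (hw : w ≠ []) (hne : w ≠ w') :
    ∫⁻ t in Metric.ball (0 : ι → Euc d) R, ∫⁻ y,
      (B w).indicator (1 : Euc d → ℝ≥0∞) (y - projection A t (prepend w c)) *
        (B w').indicator (1 : Euc d → ℝ≥0∞) (y - projection A t (prepend w' c')) ≤
      volume (Metric.ball (0 : ι → Euc d) R) / volume (Metric.ball (0 : Euc d) R) *
        ENNReal.ofReal (b ^ 2 / (1 - ρ / (1 - ρ)) ^ d *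
          (overlapWeight A w w' / detSum A ^ (2 * w.length))) := by
  have hA : ∀ i, ‖lin (A i)‖ < 1 := fun i => (hρ i).trans_lt (by linarith)
  have hw' : w' ≠ [] := by
    rintro rfl
    exact hw (List.length_eq_zero_iff.1 hlen)
  obtain ⟨j, hj⟩ := exists_le_overlapWeight_mul_det h0 h1 hρ hA hlen hne c c'
  have hq : 0 < (1 - ρ / (1 - ρ)) ^ d := by
    refine pow_pos ?_ d
    rw [sub_pos, div_lt_one] <;> linarith
  have hL : 0 < detSum A ^ w.length := pow_pos (by linarith) _
  have hww := mul_pos (wordDet_pos hdet w) (wordDet_pos hdet w')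
  set D := LinearMap.det (diffAt hA (prepend w c) (prepend w' c') j) with hD
  have hD0 : 0 < |D| := by
    by_contra h
    have h' : |D| = 0 := le_antisymm (not_lt.1 h) (abs_nonneg _)
    rw [h', mul_zero] at hj
    exact absurd (mul_pos hq hww) (not_lt.2 hj)
  refine (lintegral_overlap_le (projectionLin hA (prepend w c)) (projectionLin hA (prepend w' c'))
    (j := j) (abs_pos.1 hD0) hR (hB.measurable w hw) (hB.measurable w' hw')).trans ?_
  rw [mul_assoc]
  refine mul_le_mul_right ?_ _
  have e1 := hB.volume_le w hw
  have e2 := hB.volume_le w' hw'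
  rw [← hlen] at e2
  have hnn : ∀ v, 0 ≤ b * (wordDet A v / detSum A ^ w.length) := fun v =>
    mul_nonneg hb (div_nonneg (abs_nonneg _) hL.le)
  calc _ ≤ ENNReal.ofReal |D⁻¹| * ENNReal.ofReal (b * (wordDet A w' / detSum A ^ w.length)) *
        ENNReal.ofReal (b * (wordDet A w / detSum A ^ w.length)) := by
        exact mul_le_mul' (mul_le_mul' le_rfl e2) e1
    _ = ENNReal.ofReal (b ^ 2 * (wordDet A w * wordDet A w' / |D|) /
          detSum A ^ (2 * w.length)) := by
        rw [← ENNReal.ofReal_mul (abs_nonneg _),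
          ← ENNReal.ofReal_mul (mul_nonneg (abs_nonneg _) (hnn _)), abs_inv]
        congr 1
        rw [two_mul, pow_add]
        field_simp
    _ ≤ _ := by
        refine ENNReal.ofReal_le_ofReal ?_
        have : wordDet A w * wordDet A w' / |D| ≤ overlapWeight A w w' / (1 - ρ / (1 - ρ)) ^ d := by
          rw [div_le_div_iff₀ hD0 hq]
          linarith
        calc _ ≤ b ^ 2 * (overlapWeight A w w' / (1 - ρ / (1 - ρ)) ^ d) /
              detSum A ^ (2 * w.length) := by gcongr
          _ = _ := by ring

/-- The second moments of the counting functions, averaged over a ball of translations, are bounded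
uniformly in the length of the words. Length zero is left out, because nothing is assumed about the
set that belongs to the empty word. -/
theorem exists_lintegral_levelCount_sq_le {ρ : ℝ} (h0 : 0 ≤ ρ) (h1 : ρ < 1 / 2)
    (hρ : ∀ i, ‖lin (A i)‖ ≤ ρ) (hdet : ∀ i, (A i).det ≠ 0) (hlam : 1 < detSum A) (hb : 0 ≤ b)
    (hB : IsWordTarget A B a b) {R : ℝ} (hR : 0 < R) :
    ∃ K : ℝ≥0∞, K ≠ ⊤ ∧ ∀ n, ∫⁻ t in Metric.ball (0 : ι → Euc d) R,
      ∫⁻ y, levelCount A c B (n + 1) t y ^ 2 ≤ K := by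
  classical
  have hA : ∀ i, ‖lin (A i)‖ < 1 := fun i => (hρ i).trans_lt (by linarith)
  have hq : 0 < (1 - ρ / (1 - ρ)) ^ d := by
    refine pow_pos ?_ d
    rw [sub_pos, div_lt_one] <;> linarith
  set V := volume (Metric.ball (0 : ι → Euc d) R)
  set V' := V / volume (Metric.ball (0 : Euc d) R)
  set q := b ^ 2 / (1 - ρ / (1 - ρ)) ^ d with hqd
  have hq0 : 0 ≤ q := by positivity
  have hV : V ≠ ⊤ := measure_ball_lt_top.ne
  have hV' : V' ≠ ⊤ := ENNReal.div_ne_top hV (Metric.measure_ball_pos _ _ hR).ne'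
  refine ⟨V' * ENNReal.ofReal (q * (detSum A / (detSum A - 1))) + V * ENNReal.ofReal b,
    ENNReal.add_ne_top.2 ⟨ENNReal.mul_ne_top hV' ENNReal.ofReal_ne_top,
      ENNReal.mul_ne_top hV ENNReal.ofReal_ne_top⟩, fun n => ?_⟩
  have hL : 0 < detSum A ^ (2 * (n + 1)) := pow_pos (by linarith) _
  let g : (Fin (n + 1) → ι) → (ι → Euc d) → Euc d → ℝ≥0∞ := fun w t y =>
    (B (List.ofFn w)).indicator 1 (y - projection A t (prepend (List.ofFn w) (c (List.ofFn w))))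
  have hg : ∀ w, Measurable (Function.uncurry (g w)) := fun w =>
    (measurable_one.indicator (hB.measurable _ (ofFn_ne_nil w))).comp
      (measurable_snd.sub ((continuous_projection hA _).measurable.comp measurable_fst))
  have hgg : ∀ w w', Measurable (Function.uncurry fun t y => g w t y * g w' t y) := fun w w' =>
    (hg w).mul (hg w')
  have hexp : ∀ t, ∫⁻ y, levelCount A c B (n + 1) t y ^ 2 =
      ∑ w, ∑ w', ∫⁻ y, g w t y * g w' t y := by
    intro t
    have : ∀ y, levelCount A c B (n + 1) t y ^ 2 = ∑ w, ∑ w', g w t y * g w' t y := by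
      intro y
      rw [sq, levelCount, Finset.sum_mul_sum]
    simp_rw [this]
    rw [lintegral_finsetSum]
    · refine Finset.sum_congr rfl fun w _ => ?_
      rw [lintegral_finsetSum]
      exact fun w' _ => (hgg w w').comp measurable_prodMk_left
    · exact fun w _ => Finset.measurable_sum _ fun w' _ =>
        (hgg w w').comp measurable_prodMk_left
  have hpair : ∀ w w', ∫⁻ t in Metric.ball (0 : ι → Euc d) R, ∫⁻ y, g w t y * g w' t y ≤
      V' * ENNReal.ofReal (q * (overlapWeight A (List.ofFn w) (List.ofFn w') /
        detSum A ^ (2 * (n + 1)))) + if w = w' then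
          V * ENNReal.ofReal (b * (wordDet A (List.ofFn w) / detSum A ^ (n + 1))) else 0 := by
    intro w w'
    by_cases h : w = w'
    · subst h
      rw [if_pos rfl]
      refine le_add_left ?_
      have hsq : ∀ t, ∫⁻ y, g w t y * g w t y ≤
          ENNReal.ofReal (b * (wordDet A (List.ofFn w) / detSum A ^ (n + 1))) := by
        intro t
        have hv := hB.volume_le _ (ofFn_ne_nil w)
        rw [List.length_ofFn] at hv
        refine le_trans (le_of_eq ?_) hv
        rw [← lintegral_indicator_sub (hB.measurable _ (ofFn_ne_nil w))
          (projection A t (prepend (List.ofFn w) (c (List.ofFn w))))]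
        refine lintegral_congr fun y => ?_
        simp only [g]
        by_cases hy : y - projection A t (prepend (List.ofFn w) (c (List.ofFn w))) ∈
          B (List.ofFn w)
        · simp only [indicator_of_mem hy, Pi.one_apply, mul_one]
        · simp only [indicator_of_notMem hy, mul_zero]
      refine (lintegral_mono hsq).trans ?_
      rw [lintegral_const, Measure.restrict_apply_univ, mul_comm]
    · rw [if_neg h, add_zero]
      have := lintegral_pair_le h0 h1 hρ hdet hlam hb hB hR (c (List.ofFn w)) (c (List.ofFn w'))
        (w := List.ofFn w) (w' := List.ofFn w') (by simp) (ofFn_ne_nil w)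
        (fun he => h (List.ofFn_injective he))
      rwa [List.length_ofFn] at this
  simp_rw [hexp]
  have hmm : ∀ w w', Measurable fun t => ∫⁻ y, g w t y * g w' t y := fun w w' =>
    (hgg w w').lintegral_prod_right'
  rw [lintegral_finsetSum _ fun w _ => Finset.measurable_sum _ fun w' _ => hmm w w']
  simp_rw [fun w => lintegral_finsetSum (μ := volume.restrict (Metric.ball (0 : ι → Euc d) R))
    Finset.univ fun w' _ => hmm w w']
  refine (Finset.sum_le_sum fun w _ => Finset.sum_le_sum fun w' _ => hpair w w').trans ?_
  simp only [Finset.sum_add_distrib, Finset.sum_ite_eq, Finset.mem_univ, if_true,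
    ← Finset.mul_sum]
  gcongr
  · exact sum_ofReal_overlapWeight_le hlam hq0 (n + 1)
  · exact (sum_ofReal_wordDet hlam hb (n + 1)).le

end Cover

/-- In a set of finite measure, the measure of a limsup of sets is at least the limsup of their
measures. -/
theorem measure_setOf_frequently_pos {α : Type*} [MeasurableSpace α] {μ : Measure α}
    {U : ℕ → Set α} (hU : ∀ n, 1 ≤ n → MeasurableSet (U n)) {s : Set α} (hs : μ s ≠ ⊤)
    (hUs : ∀ n, 1 ≤ n → U n ⊆ s) (h : 0 < limsup (fun n => μ (U n)) atTop) :
    0 < μ {y | ∃ᶠ n in atTop, y ∈ U n} := by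
  let F : ℕ → Set α := fun N => ⋃ n, U (N + 1 + n)
  have hFU : ∀ N, U (N + 1) ⊆ F N := fun N => subset_iUnion (fun n => U (N + 1 + n)) 0
  have hF : Antitone F := by
    refine antitone_nat_of_succ_le fun N => iUnion_subset fun n => ?_
    refine subset_iUnion_of_subset (n + 1) ?_
    rw [show N + 1 + 1 + n = N + 1 + (n + 1) by ring]
  have hlim := tendsto_measure_iInter_atTop (μ := μ) (s := F)
    (fun N => (MeasurableSet.iUnion fun n => hU _ (by omega)).nullMeasurableSet) hF
    ⟨0, ((measure_mono (iUnion_subset fun n => hUs _ (by omega))).trans_lt hs.lt_top).ne⟩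
  have hsub : ⋂ N, F N ⊆ {y | ∃ᶠ n in atTop, y ∈ U n} := by
    intro y hy
    refine frequently_atTop.2 fun N => ?_
    obtain ⟨n, hn⟩ := mem_iUnion.1 (mem_iInter.1 hy N)
    exact ⟨N + 1 + n, by omega, hn⟩
  refine lt_of_lt_of_le ?_ (measure_mono hsub)
  refine h.trans_le ?_
  rw [← limsup_nat_add _ 1, ← hlim.limsup_eq]
  exact limsup_le_limsup (Eventually.of_forall fun N => measure_mono (hFU N))

theorem infinite_of_frequently {ι : Type*} {P : List ι → Prop}
    (h : ∃ᶠ n in atTop, ∃ w : List ι, w.length = n ∧ P w) : {w | w ≠ [] ∧ P w}.Infinite := by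
  intro hfin
  obtain ⟨N, hN⟩ := (hfin.image List.length).bddAbove
  obtain ⟨n, hn, w, rfl, hw⟩ := frequently_atTop.1 h (N + 1)
  have hw0 : w ≠ [] := by rintro rfl; simp at hn
  have := hN ⟨w, ⟨hw0, hw⟩, rfl⟩
  omega

theorem norm_le_of_mem_cube {d : ℕ} {Q : ℝ} {x : Euc d} (hx : x ∈ cube d Q) : ‖x‖ ≤ √d * Q := by
  rcases Nat.eq_zero_or_pos d with rfl | hd
  · rw [Subsingleton.elim x 0]; simp
  have hQ : 0 ≤ Q := by
    have := hx ⟨0, hd⟩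
    linarith [this.1, this.2]
  rw [EuclideanSpace.norm_eq]
  refine Real.sqrt_le_iff.2 ⟨by positivity, ?_⟩
  calc ∑ k, ‖x k‖ ^ 2 ≤ ∑ _k : Fin d, Q ^ 2 := by
        refine Finset.sum_le_sum fun k _ => ?_
        rw [Real.norm_eq_abs]
        exact pow_le_pow_left₀ (abs_nonneg _) (abs_le.2 (hx k)) 2
    _ = (√d * Q) ^ 2 := by
        rw [mul_pow, Real.sq_sqrt (Nat.cast_nonneg _)]
        simp

section Cover

variable {d : ℕ} {ι : Type*} [Fintype ι]

variable {A : ι → Matrix (Fin d) (Fin d) ℝ} {c : List ι → ℕ → ι} {B : List ι → Set (Euc d)}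
  {a b : ℝ}

theorem nonempty_of_one_lt_detSum (hlam : 1 < detSum A) : Nonempty ι := by
  by_contra h
  rw [not_nonempty_iff] at h
  simp [detSum] at hlam
  linarith

theorem measurableSet_levelCover (hB : IsWordTarget A B a b) (t : ι → Euc d) {n : ℕ} (hn : 1 ≤ n) :
    MeasurableSet (levelCover A t c B n) := by
  have : levelCover A t c B n = ⋃ w : {w : List ι // w.length = n},
      (fun y => y - projection A t (prepend w.1 (c w.1))) ⁻¹' B w.1 := by
    ext y
    simp [levelCover]
  rw [this]
  refine MeasurableSet.iUnion fun w => (hB.measurable _ ?_).preimage (measurable_id.sub_const _)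
  rintro h
  have := w.2
  rw [h] at this
  simp at this
  omega

/-- For almost every choice of the translations, the covers of level `n` do not become negligible.
The second moment method applies to the translations in a ball, and countably many balls exhaust the
space. -/
theorem ae_limsup_levelCover_pos (hnorm : ∀ i, ‖lin (A i)‖ < 1 / 2)
    (hdet : ∀ i, (A i).det ≠ 0) (hlam : 1 < detSum A) (ha : 0 < a) (hb : 0 ≤ b)
    (hB : IsWordTarget A B a b) (c : List ι → ℕ → ι) :
    ∀ᵐ t : ι → Euc d, 0 < limsup (fun n => volume (levelCover A t c B n)) atTop := by
  have hne := nonempty_of_one_lt_detSum hlam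
  obtain ⟨k, hk⟩ := Finite.exists_max fun i => ‖lin (A i)‖
  have hA : ∀ i, ‖lin (A i)‖ < 1 := fun i => (hnorm i).trans (by norm_num)
  have hbox : ∀ R : ℕ, ∀ᵐ t : ι → Euc d, t ∈ Metric.ball (0 : ι → Euc d) ((R : ℝ) + 1) →
      0 < limsup (fun n => volume (levelCover A t c B n)) atTop := by
    intro R
    rw [← ae_restrict_iff' measurableSet_ball]
    obtain ⟨K, hK, hsq⟩ := exists_lintegral_levelCount_sq_le (c := c) (norm_nonneg _) (hnorm k) hk
      hdet hlam hb hB (R := (R : ℝ) + 1) (by positivity)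
    have := ae_limsup_pos_of_second_moment
      (fun n => measurable_levelCount (c := c) hA hB n) (ENNReal.ofReal_pos.2 ha).ne' hK
      (fun n t => le_lintegral_levelCount hlam ha.le hB n t) hsq
    simp_rw [setOf_levelCount_ne_zero] at this
    filter_upwards [this] with t ht
    rwa [limsup_nat_add (fun n => volume (levelCover A t c B n)) 1] at ht
  filter_upwards [ae_all_iff.2 hbox] with t ht
  obtain ⟨R, hR⟩ := exists_nat_gt ‖t‖
  exact ht R (by rw [mem_ball_zero_iff]; linarith)

theorem projection_mem (hA : ∀ i, ‖lin (A i)‖ < 1) (t : ι → Euc d) (i : ℕ → ι) :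
    projection A t i ∈ selfAffineSet A t := by
  have : Nonempty ι := ⟨i 0⟩
  exact (isSelfAffineSet_range_projection t hA).subset t hA (isSelfAffineSet_selfAffineSet t hA)
    (mem_range_self i)

/-- If the sets `B_w` shrink to the origin, then the points that lie in infinitely many covers
belong to the self-affine set, which is closed and contains all projections. -/
theorem volume_inter_frequently_levelCover_pos (hA : ∀ i, ‖lin (A i)‖ < 1)
    (hlam : 1 < detSum A) (hB : IsWordTarget A B a b) {Q ρ : ℝ} (h0 : 0 ≤ ρ) (h1 : ρ < 1)
    (hQ : ∀ w, w ≠ [] → ∀ z ∈ B w, ‖z‖ ≤ Q * ρ ^ w.length) (t : ι → Euc d)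
    (h : 0 < limsup (fun n => volume (levelCover A t c B n)) atTop) :
    0 < volume {y | y ∈ selfAffineSet A t ∧ ∃ᶠ n in atTop, y ∈ levelCover A t c B n} := by
  have hne := nonempty_of_one_lt_detSum hlam
  have hX := isSelfAffineSet_selfAffineSet t hA
  have hdist : ∀ n, 1 ≤ n → ∀ y ∈ levelCover A t c B n,
      Metric.infDist y (selfAffineSet A t) ≤ Q * ρ ^ n := by
    rintro n hn y ⟨w, rfl, hw⟩
    have hw0 : w ≠ [] := by rintro rfl; simp at hn
    refine (Metric.infDist_le_dist_of_mem (projection_mem hA t (prepend w (c w)))).trans ?_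
    rw [dist_eq_norm]
    exact hQ w hw0 _ hw
  have hsub : {y | ∃ᶠ n in atTop, y ∈ levelCover A t c B n} ⊆
      {y | y ∈ selfAffineSet A t ∧ ∃ᶠ n in atTop, y ∈ levelCover A t c B n} := by
    intro y hy
    refine ⟨?_, hy⟩
    rw [hX.2.1.isClosed.mem_iff_infDist_zero hX.1]
    refine le_antisymm ?_ Metric.infDist_nonneg
    have hlim : Tendsto (fun n : ℕ => Q * ρ ^ n) atTop (𝓝 0) := by
      simpa using (tendsto_pow_atTop_nhds_zero_of_lt_one h0 h1).const_mul Q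
    refine ge_of_tendsto_of_frequently hlim ?_
    exact (Frequently.and_eventually hy (eventually_ge_atTop 1)).mono fun n hn =>
      hdist n hn.2 y hn.1
  refine lt_of_lt_of_le ?_ (measure_mono hsub)
  obtain ⟨r, hr⟩ := hX.2.1.isBounded.subset_closedBall 0
  refine measure_setOf_frequently_pos (fun n hn => measurableSet_levelCover hB t hn)
    (s := Metric.closedBall 0 (r + |Q|)) measure_closedBall_lt_top.ne ?_ h
  rintro n hn y ⟨w, rfl, hw⟩
  have hw0 : w ≠ [] := by rintro rfl; simp at hn
  have e1 := hr (projection_mem hA t (prepend w (c w)))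
  have e2 := hQ w hw0 _ hw
  rw [mem_closedBall_zero_iff] at e1 ⊢
  have e3 : Q * ρ ^ w.length ≤ |Q| := by
    calc Q * ρ ^ w.length ≤ |Q| * ρ ^ w.length := by gcongr; exact le_abs_self Q
      _ ≤ |Q| * 1 := by gcongr; exact pow_le_one₀ h0 h1.le
      _ = |Q| := mul_one _
  calc ‖y‖ = ‖projection A t (prepend w (c w)) + (y - projection A t (prepend w (c w)))‖ := by
        congr 1; abel
    _ ≤ _ := (norm_add_le _ _).trans (by linarith)

end Cover

/-! ### Shrinking targets and recurrence -/

section Targets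

variable {d : ℕ} {ι : Type*} [Fintype ι] {A : ι → Matrix (Fin d) (Fin d) ℝ}

theorem mem_vadd_set_iff_sub_mem {x y : Euc d} {E : Set (Euc d)} : y ∈ x +ᵥ E ↔ y - x ∈ E := by
  rw [mem_vadd_set_iff_neg_vadd_mem, vadd_eq_add, neg_add_eq_sub]

/-- Shrinking targets of measure `a λ ^ (-n)` around coded points. As `T_w` maps the projection of
`w c` to the projection of `c`, it maps `y` into the target exactly if `y` lies in the translate of
`A_w E` by the projection of `w c`. -/
theorem ae_targets (hdet : ∀ i, (A i).det ≠ 0) (hnorm : ∀ i, ‖lin (A i)‖ < 1 / 2)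
    (hlam : 1 < detSum A) (c : ℕ → ℕ → ι) {E : ℕ → Set (Euc d)}
    (hE : ∀ n, 1 ≤ n → MeasurableSet (E n)) {a Q : ℝ} (ha : 0 < a)
    (hvol : ∀ n, 1 ≤ n → volume (E n) = ENNReal.ofReal (a * (detSum A ^ n)⁻¹))
    (hQ : ∀ n, 1 ≤ n → ∀ x ∈ E n, ‖x‖ ≤ Q) :
    (∀ᵐ t : ι → Euc d,
      0 < limsup (fun n : ℕ => volume (levelTargetSet A t n (projection A t (c n)) (E n))) atTop) ∧
    (∀ᵐ t : ι → Euc d, 0 < volume (targetSet A t (fun n => projection A t (c n)) E)) := by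
  have hA : ∀ i, ‖lin (A i)‖ < 1 := fun i => (hnorm i).trans (by norm_num)
  obtain ⟨ρ, h0, h1, hρ⟩ := exists_contraction_bound hA
  let B : List ι → Set (Euc d) := fun w => lin (wordProd A w)⁻¹ ⁻¹' E w.length
  have hBvol : ∀ w, w ≠ [] →
      volume (B w) = ENNReal.ofReal (a * (wordDet A w / detSum A ^ w.length)) := by
    intro w hw
    rw [volume_preimage_lin_inv hdet, hvol _ (List.length_pos_of_ne_nil hw),
      ← ENNReal.ofReal_mul (wordDet_pos hdet w).le]
    congr 1
    ring
  have hB : IsWordTarget A B a a :=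
    ⟨fun w hw => (lin (wordProd A w)⁻¹).continuous.measurable (hE _ (List.length_pos_of_ne_nil hw)),
      fun w hw => (hBvol w hw).ge, fun w hw => (hBvol w hw).le⟩
  have hcover : ∀ t n, levelTargetSet A t n (projection A t (c n)) (E n) =
      levelCover A t (fun w => c w.length) B n := by
    intro t n
    ext y
    refine exists_congr fun w => and_congr_right ?_
    rintro rfl
    rw [mem_vadd_set_iff_sub_mem, mem_preimage, ← TWord_sub t hdet, projection_prepend t hA,
      TWord_SWord t hdet]
  have hlim := ae_limsup_levelCover_pos hnorm hdet hlam ha ha.le hB (fun w => c w.length)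
  refine ⟨?_, ?_⟩
  · simpa only [hcover] using hlim
  · filter_upwards [hlim] with t ht
    refine (volume_inter_frequently_levelCover_pos hA hlam hB h0 h1 (Q := Q) ?_ t ht).trans_le
      (measure_mono ?_)
    · intro w hw z hz
      rw [← lin_wordProd_inv hdet w z, mul_comm]
      refine (norm_wordProd_le h0 hρ w _).trans ?_
      gcongr
      exact hQ _ (List.length_pos_of_ne_nil hw) _ hz
    · rintro y ⟨hy, hf⟩
      refine ⟨hy, infinite_of_frequently
        (P := fun w => TWord A t w y ∈ projection A t (c w.length) +ᵥ E w.length) ?_⟩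
      refine hf.mono fun n hn => ?_
      rw [← hcover] at hn
      obtain ⟨w, rfl, hw⟩ := hn
      exact ⟨w, rfl, hw⟩

/-- Recurrence with targets of measure `λ ^ (-n)`. The projection `p` of the periodic sequence
`w w w ⋯` is a fixed point of `T_w`, so that `T_w y ∈ y + E` says that `(1 - A_w) (y - p) ∈ A_w E`.
The determinant of `1 - A_w` is bounded above and away from zero, since `‖A_w‖ ≤ 1 / 2`. -/
theorem ae_recurrence (hdet : ∀ i, (A i).det ≠ 0) (hnorm : ∀ i, ‖lin (A i)‖ < 1 / 2)
    (hlam : 1 < detSum A) {E : ℕ → Set (Euc d)}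
    (hE : ∀ n, 1 ≤ n → MeasurableSet (E n)) {Q : ℝ}
    (hvol : ∀ n, 1 ≤ n → volume (E n) = ENNReal.ofReal ((detSum A ^ n)⁻¹))
    (hQ : ∀ n, 1 ≤ n → ∀ x ∈ E n, ‖x‖ ≤ Q) :
    (∀ᵐ t : ι → Euc d, 0 < limsup (fun n : ℕ => volume (levelRecurrenceSet A t n (E n))) atTop) ∧
    (∀ᵐ t : ι → Euc d, 0 < volume (recurrenceSet A t E)) := by
  have hA : ∀ i, ‖lin (A i)‖ < 1 := fun i => (hnorm i).trans (by norm_num)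
  have hne := nonempty_of_one_lt_detSum hlam
  obtain ⟨k, hk⟩ := Finite.exists_max fun i => ‖lin (A i)‖
  set ρ := ‖lin (A k)‖
  have h0 : 0 ≤ ρ := norm_nonneg _
  have h1 : ρ < 1 / 2 := hnorm k
  have hρn : ∀ w : List ι, w ≠ [] → ρ ^ w.length ≤ 1 / 2 := fun w hw =>
    (pow_le_of_le_one h0 (by linarith) (by have := List.length_pos_of_ne_nil hw; omega)).trans h1.le
  have hhalf : ∀ w : List ι, w ≠ [] → ∀ x, ‖lin (wordProd A w) x‖ ≤ 1 / 2 * ‖x‖ := fun w hw x =>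
    (norm_wordProd_le h0 hk w x).trans (mul_le_mul_of_nonneg_right (hρn w hw) (norm_nonneg _))
  let F : List ι → Euc d →ₗ[ℝ] Euc d := fun w =>
    LinearMap.id - (lin (wordProd A w) : Euc d →ₗ[ℝ] Euc d)
  have hF : ∀ w x, F w x = x - lin (wordProd A w) x := fun w x => rfl
  have hF1 : ∀ w, w ≠ [] → (1 / 2 : ℝ) ^ d ≤ |LinearMap.det (F w)| := fun w hw =>
    le_abs_det (by norm_num) fun x => by
      rw [hF]
      linarith [norm_sub_norm_le x (lin (wordProd A w) x), hhalf w hw x]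
  have hF2 : ∀ w, w ≠ [] → |LinearMap.det (F w)| ≤ (2 : ℝ) ^ d := fun w hw =>
    abs_det_le (by norm_num) fun x => by
      rw [hF]
      linarith [norm_sub_le x (lin (wordProd A w) x), hhalf w hw x, norm_nonneg x]
  have hF0 : ∀ w, w ≠ [] → 0 < |LinearMap.det (F w)| := fun w hw =>
    (by positivity : (0 : ℝ) < (1 / 2) ^ d).trans_le (hF1 w hw)
  let B : List ι → Set (Euc d) := fun w => F w ⁻¹' (lin (wordProd A w)⁻¹ ⁻¹' E w.length)
  have hBvol : ∀ w, w ≠ [] → volume (B w) =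
      ENNReal.ofReal (|LinearMap.det (F w)|⁻¹ * (wordDet A w / detSum A ^ w.length)) := by
    intro w hw
    rw [Measure.addHaar_preimage_linearMap _ (abs_pos.1 (hF0 w hw)), volume_preimage_lin_inv hdet,
      hvol _ (List.length_pos_of_ne_nil hw), ← ENNReal.ofReal_mul (wordDet_pos hdet w).le,
      ← ENNReal.ofReal_mul (abs_nonneg _), abs_inv]
    rfl
  have hnn : ∀ w : List ι, 0 ≤ wordDet A w / detSum A ^ w.length := fun w =>
    div_nonneg (abs_nonneg _) (pow_nonneg (by linarith) _)
  have hB : IsWordTarget A B ((2 : ℝ) ^ d)⁻¹ ((1 / 2 : ℝ) ^ d)⁻¹ := by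
    refine ⟨fun w hw => ?_, fun w hw => ?_, fun w hw => ?_⟩
    · exact (F w).continuous_of_finiteDimensional.measurable
        ((lin (wordProd A w)⁻¹).continuous.measurable (hE _ (List.length_pos_of_ne_nil hw)))
    · rw [hBvol w hw]
      exact ENNReal.ofReal_le_ofReal (mul_le_mul_of_nonneg_right
        (inv_anti₀ (hF0 w hw) (hF2 w hw)) (hnn w))
    · rw [hBvol w hw]
      exact ENNReal.ofReal_le_ofReal (mul_le_mul_of_nonneg_right
        (inv_anti₀ (by positivity) (hF1 w hw)) (hnn w))
  have hcyc : ∀ w : List ι, ∃ c : ℕ → ι, w ≠ [] → prepend w c = c := by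
    intro w
    by_cases hw : w = []
    · exact ⟨fun _ => k, fun h => absurd hw h⟩
    · exact (exists_prepend_eq_self hw).imp fun c hc _ => hc
  choose c hc using hcyc
  have hcover : ∀ t n, 1 ≤ n → levelRecurrenceSet A t n (E n) = levelCover A t c B n := by
    intro t n hn
    ext y
    refine exists_congr fun w => and_congr_right ?_
    rintro rfl
    have hw : w ≠ [] := by rintro rfl; simp at hn
    have hfix : TWord A t w (projection A t (prepend w (c w))) =
        projection A t (prepend w (c w)) := by
      nth_rewrite 1 [projection_prepend t hA]
      rw [TWord_SWord t hdet, hc w hw]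
    rw [mem_vadd_set_iff_sub_mem, mem_preimage, mem_preimage, hF, map_sub, lin_inv_wordProd hdet,
      ← TWord_sub t hdet, hfix, sub_sub_sub_cancel_right]
  have hlim := ae_limsup_levelCover_pos hnorm hdet hlam (by positivity) (by positivity) hB c
  refine ⟨?_, ?_⟩
  · filter_upwards [hlim] with t ht
    refine ht.trans_eq (limsup_congr ?_)
    filter_upwards [eventually_ge_atTop 1] with n hn
    rw [hcover t n hn]
  · filter_upwards [hlim] with t ht
    refine (volume_inter_frequently_levelCover_pos hA hlam hB h0 (by linarith) (Q := 2 * Q) ?_ t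
      ht).trans_le (measure_mono ?_)
    · intro w hw z hz
      have e1 := hQ _ (List.length_pos_of_ne_nil hw) _ hz
      have e2 := norm_wordProd_le h0 hk w (lin (wordProd A w)⁻¹ (F w z))
      rw [lin_wordProd_inv hdet, hF] at e2
      rw [hF] at e1
      have e3 := norm_sub_norm_le z (lin (wordProd A w) z)
      have e4 := hhalf w hw z
      have e5 := mul_le_mul_of_nonneg_left e1 (pow_nonneg h0 w.length)
      linarith
    · rintro y ⟨hy, hf⟩
      refine ⟨hy, infinite_of_frequently (P := fun w => TWord A t w y ∈ y +ᵥ E w.length) ?_⟩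
      refine (hf.and_eventually (eventually_ge_atTop 1)).mono fun n hn => ?_
      have hn1 := hn.1
      rw [← hcover t n hn.2] at hn1
      obtain ⟨w, rfl, hw⟩ := hn1
      exact ⟨w, rfl, hw⟩

end Targets

/-! ### Almost every point under differentiation regularity -/

theorem measurableSet_setOf_infinite {α β : Type*} [MeasurableSpace α] [Countable β]
    {P : β → α → Prop} (hP : ∀ w, MeasurableSet {y | P w y}) :
    MeasurableSet {y | {w | P w y}.Infinite} := by
  have : {y | {w | P w y}.Infinite} = ⋂ s : Finset β, ⋃ w : {w // w ∉ s}, {y | P w.1 y} := by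
    ext y
    simp only [mem_ofPred_eq, mem_iInter, mem_iUnion, Subtype.exists, exists_prop]
    constructor
    · intro h s
      obtain ⟨w, hw, hs⟩ := h.exists_notMem_finset s
      exact ⟨w, hs, hw⟩
    · intro h hfin
      obtain ⟨w, hs, hw⟩ := h hfin.toFinset
      exact hs (hfin.mem_toFinset.2 hw)
  rw [this]
  exact MeasurableSet.iInter fun s => MeasurableSet.iUnion fun w => hP w.1

section Differentiation

variable {d : ℕ} {ι : Type*} [Fintype ι] {A : ι → Matrix (Fin d) (Fin d) ℝ} {t : ι → Euc d}

theorem ballTargetSet_mono (hlam : 1 < detSum A) (x : ℕ → Euc d) {C C' : ℝ} (hC : 0 < C)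
    (h : C ≤ C') :
    ballTargetSet A t x (fun _ => C) ⊆ ballTargetSet A t x (fun _ => C') := by
  rintro y ⟨hy, hinf⟩
  refine ⟨hy, hinf.mono ?_⟩
  rintro w ⟨hw, hm⟩
  have hL : 0 < detSum A ^ w.length := pow_pos (by linarith) _
  refine ⟨hw, Metric.ball_subset_ball ?_ hm⟩
  gcongr

theorem measurableSet_ballTargetSet (hA : ∀ i, ‖lin (A i)‖ < 1) (hlam : 1 < detSum A)
    (x : ℕ → Euc d) (C : ℝ) : MeasurableSet (ballTargetSet A t x (fun _ => C)) := by
  have hne := nonempty_of_one_lt_detSum hlam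
  refine (isSelfAffineSet_selfAffineSet t hA).2.1.measurableSet.inter
    (measurableSet_setOf_infinite fun w => ?_)
  by_cases hw : w = []
  · simp [hw]
  · simp only [ne_eq, hw, not_false_eq_true, true_and]
    exact measurable_TWord t w measurableSet_ball

theorem measurableSet_iUnion_ballTargetSet (hA : ∀ i, ‖lin (A i)‖ < 1) (hlam : 1 < detSum A)
    (x : ℕ → Euc d) :
    MeasurableSet (⋃ (C : ℝ) (_ : 0 < C), ballTargetSet A t x (fun _ => C)) := by
  have : (⋃ (C : ℝ) (_ : 0 < C), ballTargetSet A t x (fun _ => C)) =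
      ⋃ k : ℕ, ballTargetSet A t x (fun _ => (k : ℝ) + 1) := by
    refine Subset.antisymm (iUnion₂_subset fun C hC => ?_) (iUnion_subset fun k => ?_)
    · obtain ⟨k, hk⟩ := exists_nat_gt C
      exact subset_iUnion_of_subset k (ballTargetSet_mono hlam x hC (by linarith))
    · exact subset_iUnion₂_of_subset ((k : ℝ) + 1) (by positivity) Subset.rfl
  rw [this]
  exact MeasurableSet.iUnion fun k => measurableSet_ballTargetSet hA hlam x _

/-- Passing from `y` to `S_i(y)` lengthens the words by one letter, which only changes the constant
in the radius of the targets. -/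
theorem S_mem_iUnion_ballTargetSet (hA : ∀ i, ‖lin (A i)‖ < 1) (hdet : ∀ i, (A i).det ≠ 0)
    (hlam : 1 < detSum A) (p : Euc d) (i : ι) {y : Euc d}
    (hy : y ∈ ⋃ (C : ℝ) (_ : 0 < C), ballTargetSet A t (fun _ => p) (fun _ => C)) :
    S A t i y ∈ ⋃ (C : ℝ) (_ : 0 < C), ballTargetSet A t (fun _ => p) (fun _ => C) := by
  have hne : Nonempty ι := ⟨i⟩
  simp only [mem_iUnion] at hy ⊢
  obtain ⟨C, hC, hyX, hinf⟩ := hy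
  have hL : 0 < detSum A := by linarith
  refine ⟨C * detSum A, mul_pos hC hL, ?_, ?_⟩
  · rw [(isSelfAffineSet_selfAffineSet t hA).2.2]
    exact mem_iUnion.2 ⟨i, y, hyX, rfl⟩
  · refine (hinf.image (List.cons_injective (a := i)).injOn).mono ?_
    rintro _ ⟨w, ⟨-, hm⟩, rfl⟩
    refine ⟨List.cons_ne_nil _ _, ?_⟩
    change TWord A t w (T A t i (S A t i y)) ∈ _
    rw [T_S A t (hdet i), List.length_cons, pow_succ, mul_div_mul_right _ _ hL.ne']
    exact hm

/-- A subset of positive measure of a differentiation regular self-affine set that every `S_i` maps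
into itself has full measure: at a density point of its complement, the copies of the subset would
take up a fixed proportion of the sets of the density basis. -/
theorem DifferentiationRegular.ae_mem (hA : ∀ i, ‖lin (A i)‖ < 1) (hlam : 1 < detSum A)
    (hreg : DifferentiationRegular A t) {W : Set (Euc d)} (hWm : MeasurableSet W)
    (hWX : W ⊆ selfAffineSet A t) (hW : ∀ i, ∀ y ∈ W, S A t i y ∈ W) (hpos : 0 < volume W) :
    ∀ᵐ x : Euc d, x ∈ selfAffineSet A t → x ∈ W := by
  have hne := nonempty_of_one_lt_detSum hlam
  have hcpt := (isSelfAffineSet_selfAffineSet t hA).2.1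
  obtain ⟨hX0, 𝒱, h𝒱, η, hη, hV⟩ := hreg
  set X := selfAffineSet A t
  have hXt : volume X ≠ ⊤ := hcpt.measure_lt_top.ne
  filter_upwards [h𝒱.density (X \ W) (hcpt.measurableSet.diff hWm) sdiff_subset] with x hx hxX
  by_contra hxW
  obtain ⟨V, hV𝒱, hxV, hVlim, hVw⟩ := hV x hxX
  have hmem : x ∈ X \ W := ⟨hxX, hxW⟩
  rw [indicator_of_mem hmem, Pi.one_apply] at hx
  have hlim := hx.comp (tendsto_inf.2 ⟨hVlim, tendsto_principal.2
    (Eventually.of_forall fun j => (⟨hV𝒱 j, hxV j⟩ : V j ∈ {V | V ∈ 𝒱 ∧ x ∈ V}))⟩)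
  set δ := ENNReal.ofReal η * (volume W / volume X)
  have hδ : 0 < δ := ENNReal.mul_pos (ENNReal.ofReal_pos.2 hη).ne'
    (ENNReal.div_pos hpos.ne' hXt).ne'
  have hle : ∀ j, volume (V j ∩ (X \ W)) / volume (V j) + δ ≤ 1 := by
    intro j
    obtain ⟨w, -, hwV, hwη⟩ := hVw j
    have hv0 : volume (V j) ≠ 0 := ((h𝒱.isOpen _ (hV𝒱 j)).measure_pos _ ⟨x, hxV j⟩).ne'
    have hvX := volume_SWord_image (A := A) t w X
    -- The set `V j` need not be bounded, but a fixed proportion of it is the measure of a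
    -- compact set.
    have hvt : volume (V j) ≠ ⊤ := by
      intro h
      rw [h, ENNReal.mul_top (ENNReal.ofReal_pos.2 hη).ne', hvX, top_le_iff] at hwη
      exact ENNReal.mul_ne_top ENNReal.ofReal_ne_top hXt hwη
    have hWle : δ * volume (V j) ≤ volume (SWord A t w '' W) := by
      calc δ * volume (V j) = (ENNReal.ofReal η * volume (V j)) * (volume W / volume X) := by
            ring
        _ ≤ volume (SWord A t w '' X) * (volume W / volume X) := by gcongr
        _ = volume (SWord A t w '' W) := by
            rw [hvX, volume_SWord_image, mul_assoc, ENNReal.mul_div_cancel hX0.ne' hXt]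
    have hdisj : Disjoint (SWord A t w '' W) (V j ∩ (X \ W)) := by
      rw [Set.disjoint_left]
      rintro _ ⟨y, hy, rfl⟩ ⟨-, -, hn⟩
      exact hn (SWord_mem_of_forall_S_mem t hW w hy)
    have hmeas : MeasurableSet (V j ∩ (X \ W)) :=
      (h𝒱.isOpen _ (hV𝒱 j)).measurableSet.inter (hcpt.measurableSet.diff hWm)
    have hsum : δ * volume (V j) + volume (V j ∩ (X \ W)) ≤ volume (V j) := by
      refine (add_le_add_left hWle _).trans ?_
      rw [← measure_union hdisj hmeas]
      exact measure_mono (union_subset ((image_mono hWX).trans hwV) inter_subset_left)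
    calc volume (V j ∩ (X \ W)) / volume (V j) + δ
        = (δ * volume (V j) + volume (V j ∩ (X \ W))) / volume (V j) := by
          rw [ENNReal.add_div, ENNReal.mul_div_cancel_right hv0 hvt, add_comm]
      _ ≤ 1 := ENNReal.div_le_of_le_mul (by rwa [one_mul])
  have h1 := le_of_tendsto' (hlim.add_const δ) hle
  exact absurd (ENNReal.lt_add_right ENNReal.one_ne_top hδ.ne') (not_lt.2 h1)

end Differentiation

end SelfAffine

theorem mainTheorem2 {d : ℕ} (hd : 1 ≤ d) {ι : Type*} [Fintype ι]
    (A : ι → Matrix (Fin d) (Fin d) ℝ)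
    (hdet : ∀ i, (A i).det ≠ 0)
    (hnorm : ∀ i, ‖lin (A i)‖ < 1 / 2)
    (hlam : 1 < detSum A) :
    -- shrinking targets
    (∀ (c : ℕ → ℕ → ι) (E : ℕ → Set (Euc d)), RegularTargets (detSum A) E →
      (∀ᵐ t : ι → Euc d,
        0 < limsup (fun n : ℕ => volume (levelTargetSet A t n (projection A t (c n)) (E n))) atTop)
      ∧ (∀ᵐ t : ι → Euc d, 0 < volume (targetSet A t (fun n => projection A t (c n)) E)))
    ∧
    -- balls centred at one coded point, under differentiation regularity
    (∀ c : ℕ → ι, (∀ᵐ t : ι → Euc d, DifferentiationRegular A t) →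
      ∀ᵐ t : ι → Euc d, ∀ᵐ x : Euc d, x ∈ selfAffineSet A t →
        x ∈ ⋃ (C : ℝ) (_ : 0 < C), ballTargetSet A t (fun _ => projection A t c) (fun _ => C))
    ∧
    -- recurrence
    (∀ E : ℕ → Set (Euc d), RegularTargets (detSum A) E →
      (∀ᵐ t : ι → Euc d,
        0 < limsup (fun n : ℕ => volume (levelRecurrenceSet A t n (E n))) atTop)
      ∧ (∀ᵐ t : ι → Euc d, 0 < volume (recurrenceSet A t E))) := by
  have hA : ∀ i, ‖lin (A i)‖ < 1 := fun i => (hnorm i).trans (by norm_num)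
  have hL : 0 < detSum A := by linarith
  refine ⟨fun c E hE => ?_, fun c hreg => ?_, fun E hE => ?_⟩
  · obtain ⟨Q, -, hQ⟩ := hE.bounded
    exact ae_targets hdet hnorm hlam c hE.measurable one_pos
      (fun n hn => by rw [one_mul, hE.volume_eq n hn])
      (fun n hn x hx => norm_le_of_mem_cube (hQ n hn hx))
  · have hvpos : 0 < volume (Metric.ball (0 : Euc d) 1) := Metric.measure_ball_pos _ _ one_pos
    have hvtop : volume (Metric.ball (0 : Euc d) 1) ≠ ⊤ := measure_ball_lt_top.ne
    have hd0 : (d : ℝ) ≠ 0 := by positivity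
    -- The balls with constant `C = 1` have measure `v * λ ^ (-n)`, where `v` is the measure of the
    -- unit ball.
    have h := (ae_targets hdet hnorm hlam (fun _ => c)
      (E := fun n => Metric.ball 0 ((1 / detSum A ^ n) ^ (1 / (d : ℝ))))
      (a := (volume (Metric.ball (0 : Euc d) 1)).toReal) (Q := 1)
      (fun n _ => measurableSet_ball) (ENNReal.toReal_pos hvpos.ne' hvtop)
      (fun n _ => by
        have hLn : 0 < 1 / detSum A ^ n := by positivity
        rw [Measure.addHaar_ball_of_pos _ _ (by positivity), finrank_euclideanSpace_fin,
          ← Real.rpow_mul_natCast hLn.le, one_div_mul_cancel hd0, Real.rpow_one, mul_comm,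
          ENNReal.ofReal_mul ENNReal.toReal_nonneg, ENNReal.ofReal_toReal hvtop, one_div])
      (fun n _ x hx => by
        rw [mem_ball_zero_iff] at hx
        refine hx.le.trans (Real.rpow_le_one (by positivity) ?_ (by positivity))
        exact (div_le_one (by positivity)).2 (one_le_pow₀ hlam.le))).2
    filter_upwards [h, hreg] with t ht htreg
    refine htreg.ae_mem hA hlam (measurableSet_iUnion_ballTargetSet hA hlam _)
      (iUnion₂_subset fun C hC y hy => hy.1)
      (fun i y hy => S_mem_iUnion_ballTargetSet hA hdet hlam _ i hy)
      (ht.trans_le (measure_mono ?_))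
    refine subset_iUnion₂_of_subset 1 one_pos ?_
    rintro y ⟨hy, hinf⟩
    refine ⟨hy, hinf.mono ?_⟩
    rintro w ⟨hw, hm⟩
    refine ⟨hw, ?_⟩
    rwa [mem_vadd_set_iff_sub_mem, mem_ball_zero_iff, ← dist_eq_norm] at hm
  · obtain ⟨Q, -, hQ⟩ := hE.bounded
    exact ae_recurrence hdet hnorm hlam hE.measurable hE.volume_eq
      (fun n hn x hx => norm_le_of_mem_cube (hQ n hn hx))
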